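/- Let $R$ be a Cohen--Macaulay normal (noetherian) local ring with canonical module $\omega$ and maximal ideal $\mathfrak m$; all modules are finitely generated, and $(-)^*=\mathrm{Hom}_R(-,R)$. Let $h(R)$ be the Grothendieck group of finitely generated $R$-modules modulo the subgroup generated by the classes of pseudo-zero modules (those $M$ with $M_{\mathfrak p}=0$ for all primes $\mathfrak p$ of height $\le 1$). Let $k(R)$ be the kernel of the rank function $h(R)\to\mathbb Z$, and write $(-)_{\mathbb R}=(-)\otimes_{\mathbb Z}\mathbb R$. Suppose that $h(R)_{\mathbb R}=\mathbb R[R]\oplus k(R)_{\mathbb R}$ is finite-dimensional, with its Euclidean topology. Let $c(R)=\sum_M\mathbb R_{\ge0}[M]\subseteq h(R)_{\mathbb R}$, where $M$ runs over the maximal Cohen--Macaulay $R$-modules, that is, those with $\operatorname{depth}M_{\mathfrak p}\ge\operatorname{height}\mathfrak p$ for all primes $\mathfrak p$ (and $\operatorname{depth}0=\infty$). Let $\overline{c(R)}$ be its closure. Then: (1) $[R]$ and $[\omega]$ belong to the interior of $c(R)$. (2) $\overline{c(R)}$ is a strongly convex cone (a convex cone $C$ with $C\cap -C=\{0\}$)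 if and only if $\overline{c(R)}\cap k(R)_{\mathbb R}=\{0\}$. (3) Suppose that $R$ is Gorenstein. Then $c(R)$ and $\overline{c(R)}$ are symmetric with respect to the axis $\mathbb R[R]$: for $a\in\mathbb R$ and $t\in k(R)_{\mathbb R}$, if $a[R]+t$ lies in the set, so does $a[R]-t$. If $M$ is a maximal Cohen--Macaulay $R$-module such that $[M]$ or $[M^*]$ belongs to the boundary of $c(R)$, then all syzygies and cosyzygies of $M$ have rank at least $\operatorname{rk}M$. (4) Without assuming that $R$ is Gorenstein: if $M$ is a totally reflexive $R$-module ($M$ is reflexive and $\mathrm{Ext}_R^i(M,R)=0=\mathrm{Ext}_R^i(M^*,R)$ for all $i>0$) such that $[M]$ or $[M^*]$ belongs to the boundary of $c(R)$, then all syzygies and cosyzygies of $M$ have rank at least $\operatorname{rk}M$. Here the conclusion on syzygies and cosyzygies in (3) and (4) means the following: $M$ has a minimal complete resolution, that is, an exact sequence $\cdots\to F_1\xrightarrow{d_1}F_0\xrightarrow{d_0}F_{-1}\to\cdots$ of finitely generated free modules with exact $R$-dual, with $\operatorname{im}d_i\subseteq\mathfrak mF_{i-1}$ for all $i\in\mathbb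 Z$ and with $M\cong\operatorname{im}d_0$; and for every such sequence, $\operatorname{rk}(\operatorname{im}d_i)\ge\operatorname{rk}M$ for all $i\in\mathbb Z$ ($\operatorname{im}d_i$ is the $i$-th syzygy for $i\ge0$ and the $(-i)$-th cosyzygy for $i\le0$). -/

import Mathlib

open scoped TensorProduct
open CategoryTheory

universe u

namespace CMCone

noncomputable section

section GrothendieckGroups

variable (R : Type u) [CommRing R]

/-- The relations `[M₂] - [M₁] - [M₃]`, one for each short exact sequence
`0 → M₁ → M₂ → M₃ → 0` of finitely generated `R`-modules. -/
def exactRelations : Set (FreeAbelianGroup (FGModuleCat.{u} R)) :=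
  {x | ∃ (M₁ M₂ M₃ : FGModuleCat.{u} R) (f : M₁ →ₗ[R] M₂) (g : M₂ →ₗ[R] M₃),
    Function.Injective f ∧ Function.Exact f g ∧ Function.Surjective g ∧
    x = FreeAbelianGroup.of M₂ - FreeAbelianGroup.of M₁ - FreeAbelianGroup.of M₃}

/-- The Grothendieck group of the category of finitely generated `R`-modules. -/
abbrev G : Type (u + 1) :=
  FreeAbelianGroup (FGModuleCat.{u} R) ⧸ AddSubgroup.closure (exactRelations R)

/-- The class of a finitely generated module in the Grothendieck group. -/
def G.mk (M : FGModuleCat.{u} R) : G R :=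
  QuotientAddGroup.mk' (AddSubgroup.closure (exactRelations R)) (FreeAbelianGroup.of M)

/-- `M` is pseudo-zero: `M_𝔭 = 0` for all primes `𝔭` of height at most one. -/
def IsPseudoZero (M : Type u) [AddCommGroup M] [Module R M] : Prop :=
  ∀ p : PrimeSpectrum R, p.asIdeal.height ≤ 1 →
    Subsingleton (LocalizedModule p.asIdeal.primeCompl M)

/-- The subgroup of the Grothendieck group generated by the classes of pseudo-zero modules. -/
def pseudoZeroSubgroup : AddSubgroup (G R) :=
  AddSubgroup.closure {x | ∃ M : FGModuleCat.{u} R, IsPseudoZero R M ∧ x = G.mk R M}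

/-- The group `h(R)`: the Grothendieck group modulo pseudo-zero modules. -/
abbrev H : Type (u + 1) := G R ⧸ pseudoZeroSubgroup R

/-- The class of a finitely generated module in `h(R)`. -/
def H.mk (M : FGModuleCat.{u} R) : H R :=
  QuotientAddGroup.mk' (pseudoZeroSubgroup R) (G.mk R M)

/-- The real vector space `h(R)_ℝ = h(R) ⊗_ℤ ℝ`. -/
abbrev HR : Type (u + 1) := ℝ ⊗[ℤ] H R

/-- `h(R)_ℝ` carries the finest vector space topology. If `h(R)_ℝ` is finite-dimensional, this is
its unique Hausdorff vector space topology, that is, the topology of the Euclidean metric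
belonging to any choice of a basis. -/
instance : TopologicalSpace (HR R) := moduleTopology ℝ (HR R)

instance : IsModuleTopology ℝ (HR R) := ⟨rfl⟩

/-- The point `[M]` of `h(R)_ℝ`. -/
def cls (M : Type u) [AddCommGroup M] [Module R M] [Module.Finite R M] : HR R :=
  (1 : ℝ) ⊗ₜ[ℤ] H.mk R (FGModuleCat.of R M)

end GrothendieckGroups

section Rank

variable (R : Type u) [CommRing R] [IsDomain R]

theorem finrank_of_isPseudoZero (M : Type u) [AddCommGroup M] [Module R M]
    (h : IsPseudoZero R M) : Module.finrank R M = 0 := by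
  apply Module.IsTorsion.finrank_eq_zero
  have h0 := h ⟨⊥, Ideal.isPrime_bot⟩ (by simp)
  rw [LocalizedModule.subsingleton_iff] at h0
  intro x
  obtain ⟨r, hr, hrx⟩ := h0 x
  exact ⟨⟨r, mem_nonZeroDivisors_of_ne_zero (by simpa [Ideal.primeCompl] using hr)⟩, hrx⟩

theorem finrank_of_exact {M₁ M₂ M₃ : Type u} [AddCommGroup M₁] [AddCommGroup M₂] [AddCommGroup M₃]
    [Module R M₁] [Module R M₂] [Module R M₃] [Module.Finite R M₂]
    (f : M₁ →ₗ[R] M₂) (g : M₂ →ₗ[R] M₃) (hf : Function.Injective f) (hfg : Function.Exact f g)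
    (hg : Function.Surjective g) :
    Module.finrank R M₂ = Module.finrank R M₁ + Module.finrank R M₃ := by
  have h := Submodule.finrank_quotient_add_finrank (LinearMap.range f)
  rw [LinearMap.finrank_range_of_inj hf,
    (hfg.linearEquivOfSurjective hg).finrank_eq] at h
  omega

/-- The rank function on the Grothendieck group of a domain. -/
def G.rk : G R →+ ℤ :=
  QuotientAddGroup.lift _
    (FreeAbelianGroup.lift fun M : FGModuleCat.{u} R => (Module.finrank R M : ℤ)) (by
      rw [AddSubgroup.closure_le]
      rintro x ⟨M₁, M₂, M₃, f, g, hf, hfg, hg, rfl⟩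
      have h := finrank_of_exact R f g hf hfg hg
      simp only [SetLike.mem_coe, AddMonoidHom.mem_ker, map_sub, FreeAbelianGroup.lift_apply_of]
      omega)

/-- The rank function on `h(R)`, where `R` is a domain. -/
def H.rk : H R →+ ℤ :=
  QuotientAddGroup.lift _ (G.rk R) (by
    rw [pseudoZeroSubgroup, AddSubgroup.closure_le]
    rintro x ⟨M, hM, rfl⟩
    have h := finrank_of_isPseudoZero R M hM
    simp only [SetLike.mem_coe, AddMonoidHom.mem_ker]
    change FreeAbelianGroup.lift (fun M : FGModuleCat.{u} R => (Module.finrank R M : ℤ))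
      (FreeAbelianGroup.of M) = 0
    rw [FreeAbelianGroup.lift_apply_of]
    exact_mod_cast h)

/-- `k(R)`, the kernel of the rank function on `h(R)`. -/
def kZ : AddSubgroup (H R) := (H.rk R).ker

/-- The subspace `k(R)_ℝ` of `h(R)_ℝ`. -/
def kR : Submodule ℝ (HR R) :=
  (AddSubgroup.toIntSubmodule (kZ R)).baseChange ℝ

end Rank

section CohenMacaulay

open RingTheory.Sequence IsLocalRing

/-- The depth of a module over a local ring: the supremum of the lengths of the (weakly) regular
sequences in the maximal ideal. It is `⊤` for the zero module. For a nonzero finitely generated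
module, a weakly regular sequence in the maximal ideal is regular, by Nakayama's lemma. -/
def depth (S : Type u) [CommRing S] [IsLocalRing S] (N : Type u) [AddCommGroup N] [Module S N] :
    ℕ∞ :=
  ⨆ (rs : List S) (_ : (∀ r ∈ rs, r ∈ maximalIdeal S) ∧ IsWeaklyRegular N rs), (rs.length : ℕ∞)

/-- The (finitely generated) `R`-module `M` is maximal Cohen--Macaulay:
`depth M_𝔭 ≥ height 𝔭` for all primes `𝔭`. -/
def IsMCM (R : Type u) [CommRing R] (M : Type u) [AddCommGroup M] [Module R M] : Prop :=
  ∀ p : PrimeSpectrum R, p.asIdeal.height ≤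
    depth (Localization.AtPrime p.asIdeal) (LocalizedModule p.asIdeal.primeCompl M)

/-- The (noetherian) ring `R` is Cohen--Macaulay. -/
def IsCohenMacaulay (R : Type u) [CommRing R] : Prop := IsMCM R R

/-- `M` has finite injective dimension. -/
def FiniteInjDim (R : Type u) [CommRing R] (M : Type u) [AddCommGroup M] [Module R M] : Prop :=
  ∃ n : ℕ, HasInjectiveDimensionLE (ModuleCat.of R M) n

/-- The (noetherian) local ring `R` is Gorenstein. -/
def IsGorenstein (R : Type u) [CommRing R] : Prop := FiniteInjDim R R

/-- `ω` is a canonical module of the Cohen--Macaulay local ring `R`: a maximal Cohen--Macaulay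
module of finite injective dimension and of type one, the type of `ω` being the dimension of
`Ext^d(k, ω)` over the residue field `k`, where `d = depth ω`. -/
structure IsCanonicalModule (R : Type u) [CommRing R] [IsLocalRing R]
    (ω : Type u) [AddCommGroup ω] [Module R ω] : Prop where
  isMCM : IsMCM R ω
  finiteInjDim : FiniteInjDim R ω
  type_one : ∃ d : ℕ, depth R ω = d ∧
    Nonempty (Abelian.Ext (ModuleCat.of R (ResidueField R)) (ModuleCat.of R ω) d
      ≃ₗ[R] ResidueField R)

/-- The cone `c(R)` in `h(R)_ℝ` of all finite sums `∑ aᵢ [Mᵢ]` with real numbers `aᵢ ≥ 0` and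
maximal Cohen--Macaulay modules `Mᵢ`. -/
def c (R : Type u) [CommRing R] : PointedCone ℝ (HR R) :=
  PointedCone.hull ℝ {x | ∃ (M : Type u) (_ : AddCommGroup M) (_ : Module R M)
    (_ : Module.Finite R M), IsMCM R M ∧ x = cls R M}

end CohenMacaulay

section Convexity

/-- `C` is a convex cone. -/
def IsConvexCone {V : Type*} [AddCommGroup V] [Module ℝ V] (C : Set V) : Prop :=
  ∀ x ∈ C, ∀ y ∈ C, ∀ a b : ℝ, 0 ≤ a → 0 ≤ b → a • x + b • y ∈ C

/-- `C` is a strongly convex cone. -/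
def IsStronglyConvexCone {V : Type*} [AddCommGroup V] [Module ℝ V] (C : Set V) : Prop :=
  IsConvexCone C ∧ C ∩ {x | -x ∈ C} = {0}

/-- The set `C` of points of `h(R)_ℝ = ℝ[R] ⊕ k(R)_ℝ` is symmetric with respect to the
axis `ℝ[R]`: it is mapped into itself by the reflection that fixes the points of `ℝ[R]` and is
multiplication by `-1` on the orthogonal complement `k(R)_ℝ` of this axis. -/
def IsSymmetricAboutAxis (R : Type u) [CommRing R] [IsDomain R] (C : Set (HR R)) : Prop :=
  ∀ (a : ℝ), ∀ t ∈ kR R, a • cls R R + t ∈ C → a • cls R R - t ∈ C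

end Convexity

section TotallyReflexive

variable (R : Type u) [CommRing R] (M : Type u) [AddCommGroup M] [Module R M]

/-- `M` is totally reflexive: it is reflexive and `Ext^i(M, R) = 0 = Ext^i(M*, R)`
for all `i > 0`. -/
structure IsTotallyReflexive : Prop where
  isReflexive : Module.IsReflexive R M
  ext_eq_zero : ∀ i : ℕ, 0 < i →
    Subsingleton (Abelian.Ext (ModuleCat.of R M) (ModuleCat.of R R) i)
  ext_dual_eq_zero : ∀ i : ℕ, 0 < i →
    Subsingleton (Abelian.Ext (ModuleCat.of R (Module.Dual R M)) (ModuleCat.of R R) i)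

/-- A minimal complete resolution of `M` over the local ring `R`: an exact sequence
`⋯ → F₁ → F₀ → F₋₁ → ⋯` of finitely generated free modules, whose `R`-dual is exact too, such that
the image of each `Fᵢ₊₁ → Fᵢ` lies in `𝔪 Fᵢ` and `M` is isomorphic to the image of `F₀ → F₋₁`.
For a totally reflexive module without nonzero free direct summands it exists and is unique up to
isomorphism. Its part in degrees `≥ 0` is the minimal free resolution of `M`.
Here `Fᵢ` is the free module of rank `b i`, and `d i` is the map `Fᵢ₊₁ → Fᵢ`. -/
structure MinimalCompleteResolution [IsLocalRing R] where
  b : ℤ → ℕ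
  d : ∀ i : ℤ, (Fin (b (i + 1)) → R) →ₗ[R] (Fin (b i) → R)
  exact : ∀ i : ℤ, Function.Exact (d (i + 1)) (d i)
  dual_exact : ∀ i : ℤ, Function.Exact (d i).dualMap (d (i + 1)).dualMap
  minimal : ∀ i : ℤ, LinearMap.range (d i) ≤ IsLocalRing.maximalIdeal R • ⊤
  iso : M ≃ₗ[R] LinearMap.range (d (-1))

variable {R M} in
/-- The `i`-th syzygy of `M`, for any integer `i`: the image of `Fᵢ → Fᵢ₋₁`. For `i = -n < 0` this
is the `n`-th cosyzygy. -/
abbrev MinimalCompleteResolution.syz [IsLocalRing R] (F : MinimalCompleteResolution R M) (i : ℤ) :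
    Submodule R (Fin (F.b (i - 1)) → R) :=
  LinearMap.range (F.d (i - 1))

/-- All syzygies and cosyzygies of `M` have rank at least the rank of `M`: minimal complete
resolutions of `M` exist, and `rank (syz^i M) ≥ rank M` for all integers `i`, the syzygies
being formed with any such resolution. -/
def SyzygyRanksGE [IsLocalRing R] : Prop :=
  Nonempty (MinimalCompleteResolution R M) ∧
    ∀ (F : MinimalCompleteResolution R M) (i : ℤ), Module.finrank R M ≤ Module.finrank R (F.syz i)

end TotallyReflexive

end

end CMCone

/-! Two facts about the cone carry the proof. The first is that `[R]` is an order unit. A syzygy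
has, up to a multiple of `[R]`, the negative of the original class, and high syzygies over a
Cohen-Macaulay ring are maximal Cohen-Macaulay. Hence for every `x` some `a[R] + x` and `a[R] - x`
both lie in `c(R)` (`exists_smul_cls_add_mem_c`). In finite dimension this makes every `ε[R] + y`
with `ε > 0` and `y ∈ c(R)` an interior point (`mem_interior_c`).

The second is duality. Only primes of height at most one matter in `h(R)`, and there a normal domain
is a field or a discrete valuation ring. This gives `[Hom(B, W)] = rk B ([W] + rk W [R]) - rk W [B]`
for torsion-free `B` and `W` (`cls_hom`). So `Hom(-, W)` acts through a linear map `dualMap` with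
square `(rk W)²`, equal to `-rk W` on `k(R)_ℝ`. If `W` is maximal Cohen-Macaulay of finite injective
dimension, then `Ext^i(N, W) = 0` for `i > 0` and `N` maximal Cohen-Macaulay
(`extVanishes_of_isMCM`), so `dualMap` preserves the cone and its closure.

For `W = ω`, applying `dualMap` to the order unit property yields (1), and `-rk ω` on `k(R)_ℝ`
yields (2), where the converse uses that ranks are nonnegative on the closure. For `W = R`
Gorenstein, `dualMap` is the reflection in (3).

For (4), each syzygy `Z` in a complete resolution has the `k`-component of `M` up to sign, and both
`Z` and `Z*` are maximal Cohen-Macaulay. If `rk Z < rk M`, each of `[M]`, `[M*]` exceeds `[Z]` or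
`[Z*]` by a positive multiple of `[R]`, so both are interior. A surjection `M → R` has the same
effect; without one, minimal resolutions of `M` and `M*` glue to a minimal complete resolution. Over
a Gorenstein ring, maximal Cohen-Macaulay modules are totally reflexive, which reduces (3) to (4).
-/

namespace CMCone

/-! ### Calculus of classes in `h(R)_ℝ` -/

section GrothendieckClasses

variable {R : Type u} [CommRing R]
variable {A B C : Type u} [AddCommGroup A] [AddCommGroup B] [AddCommGroup C]
  [Module R A] [Module R B] [Module R C] [Module.Finite R A] [Module.Finite R B] [Module.Finite R C]

theorem cls_of_exact (f : A →ₗ[R] B) (g : B →ₗ[R] C) (hf : Function.Injective f)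
    (hfg : Function.Exact f g) (hg : Function.Surjective g) :
    cls R B = cls R A + cls R C := by
  have h : G.mk R (FGModuleCat.of R B) - G.mk R (FGModuleCat.of R A) -
      G.mk R (FGModuleCat.of R C) = 0 := by
    rw [G.mk, G.mk, G.mk, ← map_sub, ← map_sub]
    exact (QuotientAddGroup.eq_zero_iff _).2 (AddSubgroup.subset_closure
      ⟨FGModuleCat.of R A, FGModuleCat.of R B, FGModuleCat.of R C, f, g, hf, hfg, hg, rfl⟩)
  have h2 : G.mk R (FGModuleCat.of R B) = G.mk R (FGModuleCat.of R A) +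
      G.mk R (FGModuleCat.of R C) := by
    rw [sub_sub, sub_eq_zero] at h
    exact h
  rw [cls, cls, cls, H.mk, h2, map_add, TensorProduct.tmul_add, H.mk, H.mk]

theorem cls_of_subsingleton [Subsingleton A] : cls R A = 0 := by
  have h := cls_of_exact (R := R) (LinearMap.id : A →ₗ[R] A) (LinearMap.id : A →ₗ[R] A)
    (fun _ _ h => h) (fun x => by simp [Subsingleton.elim x 0]) (fun x => ⟨x, rfl⟩)
  simpa using h

theorem cls_congr (e : A ≃ₗ[R] B) : cls R A = cls R B := by
  have h := cls_of_exact (R := R) e.toLinearMap (0 : B →ₗ[R] PUnit.{u + 1}) e.injective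
    (fun x => by simp) (fun x => ⟨0, Subsingleton.elim _ _⟩)
  rw [cls_of_subsingleton (A := PUnit.{u + 1}), add_zero] at h
  exact h.symm

theorem cls_submodule_add_quotient (N : Submodule R A) [Module.Finite R N] :
    cls R A = cls R N + cls R (A ⧸ N) :=
  cls_of_exact N.subtype N.mkQ N.injective_subtype
    (LinearMap.exact_subtype_mkQ N) N.mkQ_surjective

theorem cls_of_isPseudoZero (h : IsPseudoZero R A) : cls R A = 0 := by
  have : H.mk R (FGModuleCat.of R A) = 0 :=
    (QuotientAddGroup.eq_zero_iff _).2 (AddSubgroup.subset_closure ⟨FGModuleCat.of R A, h, rfl⟩)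
  rw [cls, this, TensorProduct.tmul_zero]

theorem isPseudoZero_iff {A : Type u} [AddCommGroup A] [Module R A] :
    IsPseudoZero R A ↔ ∀ p : Ideal R, p.IsPrime → p.height ≤ 1 → ∀ a : A, ∃ s ∉ p, s • a = 0 := by
  constructor
  · intro h p hp hh a
    obtain ⟨s, hs, e⟩ := LocalizedModule.subsingleton_iff.1 (h ⟨p, hp⟩ hh) a
    exact ⟨s, hs, e⟩
  · intro h p hh
    rw [LocalizedModule.subsingleton_iff]
    intro a
    obtain ⟨s, hs, e⟩ := h p.asIdeal p.2 hh a
    exact ⟨s, hs, e⟩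

theorem cls_range_add_ker [IsNoetherianRing R] {B : Type u} [AddCommGroup B] [Module R B]
    (f : A →ₗ[R] B) :
    cls R A = cls R (LinearMap.ker f) + cls R (LinearMap.range f) := by
  rw [cls_submodule_add_quotient (LinearMap.ker f), cls_congr f.quotKerEquivRange]

/-- A homomorphism with pseudo-zero kernel and cokernel identifies classes in `h(R)_ℝ`. -/
theorem cls_eq_of_pseudo_iso [IsNoetherianRing R] (f : A →ₗ[R] B)
    (hk : ∀ p : Ideal R, p.IsPrime → p.height ≤ 1 → ∀ a : A, f a = 0 → ∃ s ∉ p, s • a = 0)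
    (hc : ∀ p : Ideal R, p.IsPrime → p.height ≤ 1 → ∀ b : B, ∃ s ∉ p, ∃ a : A, f a = s • b) :
    cls R A = cls R B := by
  rw [cls_range_add_ker f, cls_submodule_add_quotient (LinearMap.range f),
    cls_of_isPseudoZero (A := LinearMap.ker f), cls_of_isPseudoZero (A := B ⧸ LinearMap.range f),
    zero_add, add_zero]
  · rw [isPseudoZero_iff]
    intro p hp hh b
    obtain ⟨b, rfl⟩ := Submodule.mkQ_surjective _ b
    obtain ⟨s, hs, a, ha⟩ := hc p hp hh b
    refine ⟨s, hs, ?_⟩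
    rw [← map_smul, ← ha, Submodule.mkQ_apply, Submodule.Quotient.mk_eq_zero]
    exact ⟨a, rfl⟩
  · rw [isPseudoZero_iff]
    rintro p hp hh ⟨a, ha⟩
    obtain ⟨s, hs, e⟩ := hk p hp hh a ha
    exact ⟨s, hs, Subtype.ext e⟩

theorem cls_prod : cls R (A × B) = cls R A + cls R B :=
  cls_of_exact (LinearMap.inl R A B) (LinearMap.snd R A B) LinearMap.inl_injective
    (LinearMap.exact_iff.2 (by rw [LinearMap.ker_snd])) LinearMap.snd_surjective

variable (R) in
theorem cls_fin_fun (n : ℕ) : cls R (Fin n → A) = n • cls R A := by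
  induction n with
  | zero => rw [zero_smul]; exact cls_of_subsingleton
  | succ n ih =>
    rw [← cls_congr (Fin.consLinearEquiv R (fun _ : Fin (n + 1) => A)), cls_prod, ih, succ_nsmul']

theorem span_range_cls :
    Submodule.span ℝ {x : HR R | ∃ (M : Type u) (_ : AddCommGroup M) (_ : Module R M)
      (_ : Module.Finite R M), x = cls R M} = ⊤ := by
  rw [eq_top_iff]
  rintro x -
  induction x using TensorProduct.induction_on with
  | zero => exact zero_mem _
  | add x y hx hy => exact add_mem hx hy
  | tmul a h =>
    have : a ⊗ₜ[ℤ] h = a • ((1 : ℝ) ⊗ₜ[ℤ] h : HR R) := by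
      rw [TensorProduct.smul_tmul', smul_eq_mul, mul_one]
    rw [this]
    clear this
    refine Submodule.smul_mem _ _ ?_
    obtain ⟨g, rfl⟩ := QuotientAddGroup.mk_surjective h
    obtain ⟨g, rfl⟩ := QuotientAddGroup.mk_surjective g
    induction g using FreeAbelianGroup.induction_on with
    | zero =>
      rw [QuotientAddGroup.mk_zero, QuotientAddGroup.mk_zero, TensorProduct.tmul_zero]
      exact zero_mem _
    | of M => exact Submodule.subset_span ⟨M, inferInstance, inferInstance, inferInstance, rfl⟩
    | neg M hM =>
      rw [QuotientAddGroup.mk_neg, QuotientAddGroup.mk_neg, TensorProduct.tmul_neg]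
      exact neg_mem hM
    | add x y hx hy =>
      rw [QuotientAddGroup.mk_add, QuotientAddGroup.mk_add, TensorProduct.tmul_add]
      exact add_mem hx hy

end GrothendieckClasses

/-! ### The real rank function and its kernel -/

section RealRank

variable (R : Type u) [CommRing R] [IsDomain R]

/-- The rank function on `h(R)_ℝ`. -/
noncomputable def rkR : HR R →ₗ[ℝ] ℝ :=
  TensorProduct.AlgebraTensorModule.lift
    (LinearMap.toSpanSingleton ℝ (H R →ₗ[ℤ] ℝ)
      ((Int.castAddHom ℝ).comp (H.rk R)).toIntLinearMap)

theorem rkR_tmul (a : ℝ) (h : H R) : rkR R (a ⊗ₜ h) = a * H.rk R h := by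
  simp [rkR]

theorem H_rk_mk (M : FGModuleCat.{u} R) : H.rk R (H.mk R M) = Module.finrank R M := by
  change FreeAbelianGroup.lift (fun M : FGModuleCat.{u} R => (Module.finrank R M : ℤ))
      (FreeAbelianGroup.of M) = _
  rw [FreeAbelianGroup.lift_apply_of]

theorem rkR_cls (M : Type u) [AddCommGroup M] [Module R M] [Module.Finite R M] :
    rkR R (cls R M) = Module.finrank R M := by
  rw [cls, rkR_tmul, H_rk_mk]
  simp

theorem kR_eq_ker : kR R = LinearMap.ker (rkR R) := by
  apply le_antisymm
  · rw [kR, Submodule.baseChange_eq_span, Submodule.span_le]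
    rintro x ⟨y, hy, rfl⟩
    have : H.rk R y = 0 := hy
    simp [rkR_tmul, this]
  -- This projection along `[R]` is checked on pure tensors; it is the identity on elements of rank
  -- zero.
  · have key : ∀ x : HR R, x - rkR R x • cls R R ∈ kR R := by
      intro x
      induction x using TensorProduct.induction_on with
      | zero => simp
      | add x y hx hy =>
        have := add_mem hx hy
        rw [map_add, add_smul]
        convert this using 1
        abel
      | tmul a h =>
        have e : a ⊗ₜ[ℤ] h - rkR R (a ⊗ₜ[ℤ] h) • cls R R =
            a • ((1 : ℝ) ⊗ₜ[ℤ] (h - H.rk R h • H.mk R (FGModuleCat.of R R)) : HR R) := by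
          rw [rkR_tmul, cls, TensorProduct.tmul_sub, smul_sub, TensorProduct.smul_tmul',
            TensorProduct.smul_tmul', smul_eq_mul, mul_one, TensorProduct.tmul_smul,
            TensorProduct.smul_tmul', TensorProduct.smul_tmul', zsmul_eq_mul]
          simp only [smul_eq_mul, mul_one]
        rw [e]
        refine Submodule.smul_mem _ _ (Submodule.tmul_mem_baseChange_of_mem _ ?_)
        change H.rk R _ = 0
        rw [map_sub, map_zsmul, H_rk_mk]
        simp
    intro x hx
    have := key x
    rw [LinearMap.mem_ker.1 hx, zero_smul, sub_zero] at this
    exact this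

end RealRank

/-! ### Torsion-free modules over a normal domain at primes of height at most one -/

section HeightOne

variable {R : Type u} [CommRing R] [IsNoetherianRing R] [IsDomain R]

theorem eq_of_le_of_height_le_one {q p : Ideal R} [q.IsPrime] [p.IsPrime] (hq : q ≠ ⊥)
    (hp : p.height ≤ 1) (h : q ≤ p) : q = p := by
  by_contra hne
  have h1 := Ideal.height_strict_mono_of_isPrime_of_isPrime (lt_of_le_of_ne h hne)
  have h2 : q.height = 0 := Order.lt_one_iff.1 (h1.trans_le hp)
  exact hq (Ideal.height_eq_zero_iff_eq_bot.1 h2)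

variable [IsIntegrallyClosed R]

/-- A normal noetherian local domain whose only possible nonzero prime is the maximal ideal is a
field or a discrete valuation ring. -/
theorem isPrincipalIdealRing_localization (q : Ideal R) [q.IsPrime] (hq : q.height ≤ 1) :
    IsPrincipalIdealRing (Localization.AtPrime q) := by
  have hm : (IsLocalRing.maximalIdeal (Localization.AtPrime q)).height ≤ 1 := by
    rw [← WithBot.coe_le_coe, IsLocalRing.maximalIdeal_height_eq_ringKrullDim,
      IsLocalization.AtPrime.ringKrullDim_eq_height q]
    exact_mod_cast hq
  have : IsNoetherianRing (Localization.AtPrime q) :=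
    IsLocalization.isNoetherianRing q.primeCompl _ inferInstance
  have : IsDomain (Localization.AtPrime q) :=
    IsLocalization.isDomain_localization q.primeCompl_le_nonZeroDivisors
  have : IsIntegrallyClosed (Localization.AtPrime q) :=
    isIntegrallyClosed_of_isLocalization _ q.primeCompl q.primeCompl_le_nonZeroDivisors
  have h : IsIntegrallyClosed (Localization.AtPrime q) ∧
      ∀ P : Ideal (Localization.AtPrime q), P ≠ ⊥ → P.IsPrime →
        P = IsLocalRing.maximalIdeal (Localization.AtPrime q) :=
    ⟨this, fun p hp0 hp => eq_of_le_of_height_le_one hp0 hm (IsLocalRing.le_maximalIdeal hp.ne_top)⟩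
  exact ((tfae_of_isNoetherianRing_of_isLocalRing_of_isDomain
    (Localization.AtPrime q)).out 3 0).1 h

/-- A finitely generated torsion-free module over a normal domain is free in height one. -/
theorem exists_maps_comp_eq_smul (M : Type u) [AddCommGroup M] [Module R M] [Module.Finite R M]
    [Module.IsTorsionFree R M] (q : Ideal R) [q.IsPrime] (hq : q.height ≤ 1) :
    ∃ s ∉ q, ∃ (α : M →ₗ[R] (Fin (Module.finrank R M) → R))
      (β : (Fin (Module.finrank R M) → R) →ₗ[R] M),
      (∀ m, β (α m) = s • m) ∧ ∀ v, α (β v) = s • v := by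
  have := isPrincipalIdealRing_localization q hq
  have : IsDomain (Localization.AtPrime q) :=
    IsLocalization.isDomain_localization q.primeCompl_le_nonZeroDivisors
  let Mq := LocalizedModule q.primeCompl M
  let mk := LocalizedModule.mkLinearMap q.primeCompl M
  have : Module.Finite (Localization.AtPrime q) Mq :=
    Module.Finite.of_isLocalizedModule q.primeCompl mk
  have : Module.IsTorsionFree (Localization.AtPrime q) Mq :=
    IsLocalizedModule.isTorsionFree mk q.primeCompl
  have := Module.finitePresentation_of_finite R M
  have : Module.Free (Localization.AtPrime q) Mq := inferInstance
  obtain ⟨n, ⟨e⟩⟩ : ∃ n, Nonempty (Mq ≃ₗ[Localization.AtPrime q]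
      (Fin n → Localization.AtPrime q)) :=
    ⟨_, ⟨(Module.finBasis (Localization.AtPrime q) Mq).equivFun⟩⟩
  let eR := e.restrictScalars R
  let f : (Fin n → R) →ₗ[R] (Fin n → Localization.AtPrime q) :=
    LinearMap.pi fun i => (Algebra.linearMap R (Localization.AtPrime q)).comp (LinearMap.proj i)
  have hf : IsLocalizedModule q.primeCompl f :=
    IsLocalizedModule.pi q.primeCompl
      (fun _ : Fin n => Algebra.linearMap R (Localization.AtPrime q))
  have hfinj : Function.Injective f := fun v w h => funext fun i =>
    IsLocalization.injective (Localization.AtPrime q) q.primeCompl_le_nonZeroDivisors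
      (congrFun h i)
  have hmk : Function.Injective mk := by
    rw [IsLocalizedModule.injective_iff_isRegular (S := q.primeCompl)]
    intro c x y h
    exact Module.IsTorsionFree.isSMulRegular
      (IsRegular.of_ne_zero (nonZeroDivisors.ne_zero (q.primeCompl_le_nonZeroDivisors c.2))) h
  -- An isomorphism of `M_q` with a free module and its inverse are lifted to `R` with denominators
  -- `s` and `t`; both composites then become multiplication by `t * s`.
  obtain ⟨α, s, hα⟩ := Module.FinitePresentation.exists_lift_of_isLocalizedModule q.primeCompl f
    (eR.toLinearMap.comp mk)
  obtain ⟨β, t, hβ⟩ := Module.FinitePresentation.exists_lift_of_isLocalizedModule q.primeCompl mk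
    (eR.symm.toLinearMap.comp f)
  have hα' : ∀ m, f (α m) = (s : R) • eR (mk m) := fun m => LinearMap.congr_fun hα m
  have hβ' : ∀ v, mk (β v) = (t : R) • eR.symm (f v) := fun m => LinearMap.congr_fun hβ m
  have h1 : ∀ m, β (α m) = (t * s : R) • m := fun m => hmk (by
    rw [hβ', hα', map_smul, LinearEquiv.symm_apply_apply, map_smul, mul_smul])
  have h2 : ∀ v, α (β v) = (t * s : R) • v := fun v => hfinj (by
    rw [hα', hβ', map_smul, LinearEquiv.apply_symm_apply, map_smul, mul_smul, smul_comm])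
  have hs : (t * s : R) ∉ q := (q.primeCompl.mul_mem t.2 s.2)
  have hs0 : (t * s : R) ≠ 0 := fun h => hs (h ▸ q.zero_mem)
  have hβi : Function.Injective β := fun v w h => by
    have := congrArg α h
    rw [h2, h2] at this
    exact smul_right_injective _ hs0 this
  have hαi : Function.Injective α := fun v w h => by
    have := congrArg β h
    rw [h1, h1] at this
    exact smul_right_injective _ hs0 this
  have hn : Module.finrank R M = n := by
    apply le_antisymm
    · simpa using LinearMap.finrank_le_finrank_of_injective hαi
    · simpa using LinearMap.finrank_le_finrank_of_injective hβi
  subst hn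
  exact ⟨_, hs, α, β, h1, h2⟩

/-- `t` is the numerator of a generator of the maximal ideal of `R_q`; `s` is a product of
denominators, one for each of finitely many generators of `q`. -/
theorem exists_uniformizer (q : Ideal R) [q.IsPrime] (hq : q.height ≤ 1) (hq0 : q ≠ ⊥) :
    ∃ t ∈ q, t ≠ 0 ∧ ∃ s ∉ q, ∀ u ∈ q, ∃ w, s * u = t * w := by
  have := isPrincipalIdealRing_localization q hq
  obtain ⟨g, hg⟩ := (IsPrincipalIdealRing.principal
    (IsLocalRing.maximalIdeal (Localization.AtPrime q))).principal
  have hgm : g ∈ IsLocalRing.maximalIdeal (Localization.AtPrime q) := by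
    rw [hg]; exact Submodule.mem_span_singleton_self g
  obtain ⟨⟨t, c⟩, htc⟩ := IsLocalization.surj q.primeCompl g
  dsimp only at htc
  have htq : t ∈ q := by
    rw [← IsLocalization.AtPrime.to_map_mem_maximal_iff (Localization.AtPrime q) q, ← htc]
    exact Ideal.mul_mem_right _ _ hgm
  have key : ∀ u ∈ q, ∃ s ∉ q, ∃ w, s * u = t * w := by
    intro u hu
    have h1 : algebraMap R (Localization.AtPrime q) u ∈
        IsLocalRing.maximalIdeal (Localization.AtPrime q) :=
      (IsLocalization.AtPrime.to_map_mem_maximal_iff (Localization.AtPrime q) q u).2 hu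
    rw [hg, Submodule.mem_span_singleton] at h1
    obtain ⟨a, ha⟩ := h1
    obtain ⟨⟨w, d⟩, hwd⟩ := IsLocalization.surj q.primeCompl a
    dsimp only at hwd
    refine ⟨c * d, q.primeCompl.mul_mem c.2 d.2, w, ?_⟩
    apply IsLocalization.injective (Localization.AtPrime q) q.primeCompl_le_nonZeroDivisors
    rw [map_mul, map_mul, map_mul, ← ha, ← htc, ← hwd, smul_eq_mul]
    ring
  have ht0 : t ≠ 0 := by
    rintro rfl
    obtain ⟨u, hu, hu0⟩ := Submodule.exists_mem_ne_zero_of_ne_bot hq0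
    obtain ⟨s, hs, w, hw⟩ := key u hu
    rw [zero_mul, mul_eq_zero] at hw
    rcases hw with h | h
    · exact hs (h ▸ q.zero_mem)
    · exact hu0 h
  refine ⟨t, htq, ht0, ?_⟩
  have hfg : q.FG := IsNoetherian.noetherian q
  obtain ⟨S, hS⟩ := hfg
  have : ∀ u : S, ∃ s ∉ q, ∃ w, s * (u : R) = t * w := fun u =>
    key u (hS ▸ Submodule.subset_span u.2)
  choose s hs hw using this
  refine ⟨∏ u, s u, fun h => ?_, fun u hu => ?_⟩
  · obtain ⟨u, -, hu⟩ := (Ideal.IsPrime.prod_mem_iff).1 h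
    exact hs u hu
  · have : q ≤ Submodule.comap (LinearMap.mulLeft R (∏ u, s u)) (Ideal.span {t}) := by
      rw [← hS, Submodule.span_le]
      intro v hv
      obtain ⟨w, e⟩ := hw ⟨v, hv⟩
      obtain ⟨r, hr⟩ := Finset.dvd_prod_of_mem s (Finset.mem_univ ⟨v, hv⟩)
      refine Ideal.mem_span_singleton'.2 ⟨r * w, ?_⟩
      rw [LinearMap.mulLeft_apply, hr]
      linear_combination (-r) * e
    obtain ⟨a, ha⟩ := Ideal.mem_span_singleton'.1 (this hu)
    exact ⟨a, by rw [mul_comm t, ha]; rfl⟩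

end HeightOne

/-! ### The class of `Hom(B, W)` -/

section HomClass

variable {R : Type u} [CommRing R]

/-- If every value of `h` is divisible by the regular element `t`, then so is `h`. -/
theorem exists_smul_eq_of_forall_exists {B W : Type*} [AddCommGroup B] [Module R B]
    [AddCommGroup W] [Module R W] {t : R} (ht : IsSMulRegular W t) (h : B →ₗ[R] W)
    (hh : ∀ b, ∃ w, t • w = h b) : ∃ g : B →ₗ[R] W, ∀ b, t • g b = h b := by
  choose g hg using hh
  refine ⟨⟨⟨g, fun x y => ht ?_⟩, fun r x => ht ?_⟩, hg⟩
  · simp only [smul_add, hg, map_add]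
  · simp only [hg, map_smul, RingHom.id_apply, smul_comm t r]

theorem map_mem_smul_top_of_forall_mem {n : ℕ} {W : Type*} [AddCommGroup W] [Module R W]
    (q : Ideal R) (β : (Fin n → R) →ₗ[R] W) (v : Fin n → R) (hv : ∀ i, v i ∈ q) :
    β v ∈ q • (⊤ : Submodule R W) := by
  rw [LinearMap.pi_apply_eq_sum_univ]
  exact Submodule.sum_mem _ fun i _ => Submodule.smul_mem_smul (hv i) trivial

theorem forall_mem_of_mem_smul_top {n : ℕ} {W : Type*} [AddCommGroup W] [Module R W]
    (q : Ideal R) (α : W →ₗ[R] (Fin n → R)) {w : W} (hw : w ∈ q • (⊤ : Submodule R W)) (i : Fin n) :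
    α w i ∈ q := by
  have h : q • (⊤ : Submodule R W) ≤ Submodule.comap ((LinearMap.proj i).comp α) q := by
    rw [Submodule.smul_le]
    intro r hr x _
    rw [Submodule.mem_comap, map_smul, smul_eq_mul]
    exact Ideal.mul_mem_right _ _ hr
  exact h hw

variable [IsNoetherianRing R] [IsDomain R]

/-- A prime of height at most one either does not contain the nonzero prime `q` or equals it. -/
theorem exists_mem_notMem_or_eq {q p : Ideal R} [q.IsPrime] [p.IsPrime] (hq : q ≠ ⊥)
    (hp : p.height ≤ 1) : (∃ u ∈ q, u ∉ p) ∨ q = p := by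
  by_cases h : q ≤ p
  · exact Or.inr (eq_of_le_of_height_le_one hq hp h)
  · exact Or.inl (Set.not_subset.1 h)

variable [IsIntegrallyClosed R]

/-- At a prime `p ≠ q` of height at most one, an element of `q` outside `p` kills both modules. At
`q` itself `W` is free up to a factor `s ∉ q`. If `q` has height at least two, both classes vanish.
-/
theorem cls_quotient_smul_top (W : Type u) [AddCommGroup W] [Module R W] [Module.Finite R W]
    [Module.IsTorsionFree R W] (q : Ideal R) [q.IsPrime] (hq0 : q ≠ ⊥) :
    cls R (W ⧸ q • (⊤ : Submodule R W)) = Module.finrank R W • cls R (R ⧸ q) := by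
  rw [← cls_fin_fun]
  by_cases hq : q.height ≤ 1
  swap
  · rw [cls_of_isPseudoZero, cls_of_isPseudoZero] <;> rw [isPseudoZero_iff] <;> intro p hp hp1 b
    · obtain ⟨u, hu, hup⟩ | rfl := exists_mem_notMem_or_eq (p := p) hq0 hp1
      · exact ⟨u, hup, funext fun i => by
          obtain ⟨r, hr⟩ := Ideal.Quotient.mk_surjective (b i)
          rw [Pi.smul_apply, ← hr, Algebra.smul_def, Ideal.Quotient.algebraMap_eq, ← map_mul]
          exact Ideal.Quotient.eq_zero_iff_mem.2 (Ideal.mul_mem_right _ _ hu)⟩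
      · exact (hq hp1).elim
    · obtain ⟨u, hu, hup⟩ | rfl := exists_mem_notMem_or_eq (p := p) hq0 hp1
      · obtain ⟨b, rfl⟩ := Submodule.mkQ_surjective _ b
        refine ⟨u, hup, ?_⟩
        rw [← map_smul, Submodule.mkQ_apply, Submodule.Quotient.mk_eq_zero]
        exact Submodule.smul_mem_smul hu trivial
      · exact (hq hp1).elim
  obtain ⟨s, hs, α, β, h1, h2⟩ := exists_maps_comp_eq_smul W q hq
  let π : (Fin (Module.finrank R W) → R) →ₗ[R] (Fin (Module.finrank R W) → R ⧸ q) :=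
    LinearMap.pi fun i => (Submodule.mkQ q).comp (LinearMap.proj i)
  have hπ : ∀ v, π v = 0 ↔ ∀ i, v i ∈ q := fun v => by
    rw [funext_iff]
    exact forall_congr' fun i => Submodule.Quotient.mk_eq_zero q
  refine cls_eq_of_pseudo_iso (Submodule.liftQ _ (π.comp α) fun w hw => ?_) ?_ ?_
  · rw [LinearMap.mem_ker, LinearMap.comp_apply, hπ]
    exact forall_mem_of_mem_smul_top q α hw
  · intro p hp hp1 a ha
    obtain ⟨a, rfl⟩ := Submodule.mkQ_surjective _ a
    obtain ⟨u, hu, hup⟩ | rfl := exists_mem_notMem_or_eq (p := p) hq0 hp1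
    · refine ⟨u, hup, ?_⟩
      rw [← map_smul, Submodule.mkQ_apply, Submodule.Quotient.mk_eq_zero]
      exact Submodule.smul_mem_smul hu trivial
    · refine ⟨s, hs, ?_⟩
      rw [← map_smul, Submodule.mkQ_apply, Submodule.Quotient.mk_eq_zero, ← h1]
      exact map_mem_smul_top_of_forall_mem _ _ _ ((hπ _).1 ha)
  · intro p hp hp1 b
    have hb : ∃ v, π v = b := by
      choose v hv using fun i => Submodule.mkQ_surjective q (b i)
      exact ⟨v, funext hv⟩
    obtain ⟨v, rfl⟩ := hb
    obtain ⟨u, hu, hup⟩ | rfl := exists_mem_notMem_or_eq (p := p) hq0 hp1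
    · refine ⟨u, hup, 0, ?_⟩
      rw [map_zero, ← map_smul, eq_comm, hπ]
      exact fun i => Ideal.mul_mem_right _ _ hu
    · refine ⟨s, hs, Submodule.Quotient.mk (β v), ?_⟩
      rw [Submodule.liftQ_apply, LinearMap.comp_apply, h2, map_smul]

variable {A B W : Type u} [AddCommGroup A] [AddCommGroup B] [AddCommGroup W]
  [Module R A] [Module R B] [Module R W] [Module.Finite R A] [Module.Finite R B] [Module.Finite R W]
  [Module.IsTorsionFree R B] [Module.IsTorsionFree R W]

/-- If `B / A ≅ R / q` is generated by `x`, then `Hom(A, W) / Hom(B, W)` has the class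
of `W / qW`. -/
theorem cls_hom_of_quotient_prime (i : A →ₗ[R] B) (hi : Function.Injective i) (x : B)
    (hx : ∀ b, ∃ a, ∃ r : R, b = i a + r • x) (q : Ideal R) [q.IsPrime] (hq0 : q ≠ ⊥)
    (hq : ∀ r : R, r ∈ q ↔ ∃ a, i a = r • x) :
    cls R (A →ₗ[R] W) = cls R (B →ₗ[R] W) + Module.finrank R W • cls R (R ⧸ q) := by
  have htors : Module.IsTorsionFree R A := hi.moduleIsTorsionFree _ (fun r x => map_smul i r x)
  have hreg : ∀ (V : Type u) [AddCommGroup V] [Module R V] [Module.IsTorsionFree R V] (t : R),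
      t ≠ 0 → IsSMulRegular V t := fun V _ _ _ t ht =>
    Module.IsTorsionFree.isSMulRegular (isRegular_iff_ne_zero.2 ht)
  -- As `q` kills `B / A`, multiplication by `t ∈ q` on `B` factors through `A`. Composing with `μ`
  -- extends `t • f` from `A` to `B`.
  have hμ : ∀ t ∈ q, ∃ μ : B →ₗ[R] A, ∀ b, i (μ b) = t • b := by
    intro t ht
    let e := LinearEquiv.ofInjective i hi
    have hr : ∀ b, t • b ∈ LinearMap.range i := by
      intro b
      obtain ⟨a, r, rfl⟩ := hx b
      obtain ⟨a', ha'⟩ := (hq t).1 ht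
      exact ⟨t • a + r • a', by rw [map_add, map_smul, map_smul, ha', smul_add, smul_comm r t]⟩
    refine ⟨e.symm.toLinearMap.comp
      (LinearMap.codRestrict (LinearMap.range i) (LinearMap.lsmul R B t) hr), fun b => ?_⟩
    have := LinearEquiv.apply_symm_apply e ⟨t • b, hr b⟩
    exact congrArg Subtype.val this
  let ρ : (B →ₗ[R] W) →ₗ[R] (A →ₗ[R] W) := LinearMap.lcomp R W i
  have hρ : ∀ g a, ρ g a = g (i a) := fun g a => rfl
  have hρi : Function.Injective ρ := by
    intro f g hfg
    obtain ⟨t, ht, ht0⟩ := Submodule.exists_mem_ne_zero_of_ne_bot hq0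
    obtain ⟨μ, hμ⟩ := hμ t ht
    ext b
    apply hreg W t ht0
    have := LinearMap.congr_fun hfg (μ b)
    simpa [hρ, hμ] using this
  have hρq : ∀ u ∈ q, ∀ f : A →ₗ[R] W, ∃ g, ρ g = u • f := by
    intro u hu f
    obtain ⟨μ, hμ⟩ := hμ u hu
    refine ⟨f.comp μ, LinearMap.ext fun a => ?_⟩
    have : μ (i a) = u • a := hi (by rw [hμ, map_smul])
    rw [hρ, LinearMap.comp_apply, this, map_smul, LinearMap.smul_apply]
  by_cases hq1 : q.height ≤ 1
  swap
  · rw [← cls_quotient_smul_top W q hq0, cls_of_isPseudoZero (A := W ⧸ q • (⊤ : Submodule R W)),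
      add_zero]
    · symm
      refine cls_eq_of_pseudo_iso ρ (fun p hp hp1 a ha => ⟨1, hp.one_notMem, ?_⟩) ?_
      · rw [hρi (ha.trans (map_zero ρ).symm), smul_zero]
      · intro p hp hp1 f
        obtain ⟨u, hu, hup⟩ | rfl := exists_mem_notMem_or_eq (p := p) hq0 hp1
        · exact ⟨u, hup, hρq u hu f⟩
        · exact (hq1 hp1).elim
    · rw [isPseudoZero_iff]
      intro p hp hp1 b
      obtain ⟨u, hu, hup⟩ | rfl := exists_mem_notMem_or_eq (p := p) hq0 hp1
      · obtain ⟨b, rfl⟩ := Submodule.mkQ_surjective _ b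
        refine ⟨u, hup, ?_⟩
        rw [← map_smul, Submodule.mkQ_apply, Submodule.Quotient.mk_eq_zero]
        exact Submodule.smul_mem_smul hu trivial
      · exact (hq1 hp1).elim
  obtain ⟨t, htq, ht0, s₀, hs₀, hst⟩ := exists_uniformizer q hq1 hq0
  obtain ⟨a₀, ha₀⟩ := (hq t).1 htq
  -- With `i a₀ = t • x`, an extension of `f` to `B` must send `x` to `f a₀ / t`. In height one, the
  -- obstruction is therefore `f a₀` modulo `qW`: up to pseudo-isomorphism the kernel of `Φ` is
  -- `Hom(B, W)` and its image is `W / qW`.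
  let Φ : (A →ₗ[R] W) →ₗ[R] (W ⧸ q • (⊤ : Submodule R W)) :=
    (Submodule.mkQ _).comp (LinearMap.applyₗ a₀)
  have hΦ : ∀ f, Φ f = Submodule.Quotient.mk (f a₀) := fun f => rfl
  have hst' : ∀ w ∈ q • (⊤ : Submodule R W), ∃ w', t • w' = s₀ • w := by
    intro w hw
    have hle : q • (⊤ : Submodule R W) ≤ Submodule.comap (LinearMap.lsmul R W s₀)
        (LinearMap.range (LinearMap.lsmul R W t)) := by
      rw [Submodule.smul_le]
      intro u hu y _
      obtain ⟨z, hz⟩ := hst u hu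
      exact ⟨z • y, by
        rw [LinearMap.lsmul_apply, LinearMap.lsmul_apply, smul_smul, smul_smul, hz]⟩
    exact hle hw
  rw [cls_range_add_ker Φ, ← cls_quotient_smul_top W q hq0]
  congr 1
  · symm
    refine cls_eq_of_pseudo_iso (LinearMap.codRestrict (LinearMap.ker Φ) ρ fun g => ?_)
      (fun p hp hp1 a ha => ⟨1, hp.one_notMem, ?_⟩) ?_
    · rw [LinearMap.mem_ker, hΦ, hρ, ha₀, map_smul, Submodule.Quotient.mk_eq_zero]
      exact Submodule.smul_mem_smul htq trivial
    · rw [hρi ((congrArg Subtype.val ha).trans (map_zero ρ).symm), smul_zero]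
    · rintro p hp hp1 ⟨f, hf⟩
      obtain ⟨u, hu, hup⟩ | rfl := exists_mem_notMem_or_eq (p := p) hq0 hp1
      · obtain ⟨g, hg⟩ := hρq u hu f
        exact ⟨u, hup, g, Subtype.ext hg⟩
      · rw [LinearMap.mem_ker, hΦ, Submodule.Quotient.mk_eq_zero] at hf
        obtain ⟨w, hw⟩ := hst' _ hf
        obtain ⟨μ, hμ⟩ := hμ t htq
        have hμi : ∀ a, μ (i a) = t • a := fun a => hi (by rw [hμ, map_smul])
        have hμx : μ x = a₀ := hi (by rw [hμ, ha₀])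
        -- At `q`, `s₀ • f a₀ = t • w` makes `s₀ • f ∘ μ` divisible by `t` on all of `B`; the
        -- quotient `g` extends `s₀ • f`.
        obtain ⟨g, hg⟩ := exists_smul_eq_of_forall_exists (hreg W t ht0) (s₀ • f.comp μ) (by
          intro b
          obtain ⟨a, r, rfl⟩ := hx b
          refine ⟨s₀ • f a + r • w, ?_⟩
          rw [smul_add, smul_comm t r, hw, LinearMap.smul_apply, LinearMap.comp_apply, map_add,
            map_smul, hμi, hμx, map_add, map_smul, map_smul, smul_add, smul_comm t s₀,
            smul_comm r s₀])
        refine ⟨s₀, hs₀, g, Subtype.ext (LinearMap.ext fun a => hreg W t ht0 ?_)⟩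
        change t • g (i a) = t • (s₀ • f a)
        rw [hg, LinearMap.smul_apply, LinearMap.comp_apply, hμi, map_smul, smul_comm]
  · refine cls_eq_of_pseudo_iso (LinearMap.range Φ).subtype
      (fun p hp hp1 a ha => ⟨1, hp.one_notMem, ?_⟩) ?_
    · have ha0 : a = 0 := Subtype.ext ha
      rw [ha0, smul_zero]
    · intro p hp hp1 b
      obtain ⟨b, rfl⟩ := Submodule.mkQ_surjective _ b
      obtain ⟨u, hu, hup⟩ | rfl := exists_mem_notMem_or_eq (p := p) hq0 hp1
      · refine ⟨u, hup, 0, ?_⟩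
        rw [map_zero, ← map_smul, Submodule.mkQ_apply, eq_comm, Submodule.Quotient.mk_eq_zero]
        exact Submodule.smul_mem_smul hu trivial
      · obtain ⟨s, hs, α, β, h1, h2⟩ := exists_maps_comp_eq_smul A q hq1
        have hs0 : s ≠ 0 := fun h => hs (h ▸ q.zero_mem)
        -- Otherwise `a₀` would be locally divisible by `t` in `A`, so cancelling `t` in `i a₀ = t •
        -- x` would put `(s₀ * s) • x` in the image of `A`, forcing `s₀ * s ∈ q`.
        have : ∃ j, α a₀ j ∉ q := by
          by_contra! hcon
          have hv : ∀ j, ∃ w, s₀ * α a₀ j = t * w := fun j => hst _ (hcon j)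
          choose v hv using hv
          have e1 : s₀ • α a₀ = t • v := funext hv
          have e2 : i (β v) = (s₀ * s) • x := hreg B t ht0 (by
            change t • i (β v) = t • ((s₀ * s) • x)
            rw [← map_smul, ← map_smul, ← e1, map_smul, h1, map_smul, map_smul, ha₀,
              smul_smul, smul_smul, smul_smul]
            congr 1
            ring)
          have e3 := (hq _).2 ⟨_, e2⟩
          rcases Ideal.IsPrime.mem_or_mem inferInstance e3 with h | h
          · exact hs₀ h
          · exact hs h
        obtain ⟨j, hj⟩ := this
        refine ⟨α a₀ j, hj, ⟨_, ⟨(LinearMap.toSpanSingleton R W b).comp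
          ((LinearMap.proj j).comp α), rfl⟩⟩, ?_⟩
        rfl

/-- The class of `Hom(B, W)` in `h(R)_ℝ`, for torsion-free modules `B` and `W`. -/
theorem cls_hom :
    cls R (B →ₗ[R] W) + Module.finrank R W • cls R B =
      Module.finrank R B • (cls R W + Module.finrank R W • cls R R) := by
  obtain ⟨s, hs, α, β, h1, h2⟩ := exists_maps_comp_eq_smul B (⊥ : Ideal R) (by simp)
  have hs0 : s ≠ 0 := hs
  have hβ : Function.Injective β := fun v w h => by
    have := congrArg α h
    rw [h2, h2] at this
    exact smul_right_injective _ hs0 this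
  -- Noetherian induction upwards from a free submodule of full rank. Adding `R / q` on top of `N`
  -- raises `[N]` by `[R / q]` and lowers `[Hom(N, W)]` by `rk W [R / q]`, so the left side is
  -- unchanged.
  let P : Submodule R B → Prop := fun N => LinearMap.range β ≤ N ∧
    cls R (N →ₗ[R] W) + Module.finrank R W • cls R N =
      Module.finrank R B • (cls R W + Module.finrank R W • cls R R)
  have hP : P ⊤ := by
    apply WellFoundedGT.induction_top
    · refine ⟨LinearMap.range β, le_rfl, ?_⟩
      have e := LinearEquiv.ofInjective β hβ
      rw [← cls_congr e, cls_fin_fun,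
        ← cls_congr (((Pi.basisFun R (Fin (Module.finrank R B))).constr R).trans
          (e.congrLeft W R)), cls_fin_fun, smul_add, smul_comm (Module.finrank R W)]
    · rintro N hN ⟨hβN, hcls⟩
      have := Submodule.Quotient.nontrivial_iff.mpr hN
      obtain ⟨q, hq⟩ := associatedPrimes.nonempty R (B ⧸ N)
      rw [AssociatedPrimes.mem_iff, isAssociatedPrime_iff] at hq
      obtain ⟨hq, x, hqx⟩ := hq
      obtain ⟨x, rfl⟩ := Submodule.mkQ_surjective _ x
      have hqx' : ∀ r, r ∈ q ↔ r • x ∈ N := fun r => by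
        rw [hqx, Submodule.mem_colon_singleton, ← map_smul, Submodule.mem_bot,
          Submodule.mkQ_apply, Submodule.Quotient.mk_eq_zero]
      have hxN : x ∉ N := fun h => hq.one_notMem ((hqx' 1).2 (by rwa [one_smul]))
      -- `s` annihilates `B / N`, because `s • x = β (α x)`.
      have hq0 : q ≠ ⊥ := by
        rintro rfl
        refine hs0 ((hqx' s).2 (hβN (LinearMap.mem_range.2 ⟨α x, h1 x⟩)))
      have hxN' : x ∈ N ⊔ Submodule.span R {x} :=
        Submodule.mem_sup_right (Submodule.mem_span_singleton_self x)
      have hlt : N < N ⊔ Submodule.span R {x} :=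
        lt_of_le_of_ne le_sup_left fun h => hxN (h ▸ hxN')
      refine ⟨N ⊔ Submodule.span R {x}, hlt, hβN.trans le_sup_left, ?_⟩
      let i := Submodule.inclusion (le_sup_left : N ≤ N ⊔ Submodule.span R {x})
      have hi : Function.Injective i := Submodule.inclusion_injective _
      have hix : ∀ b, ∃ a, ∃ r : R, b = i a + r • (⟨x, hxN'⟩ : ↥(N ⊔ Submodule.span R {x})) := by
        rintro ⟨b, hb⟩
        obtain ⟨y, hy, z, hz, rfl⟩ := Submodule.mem_sup.1 hb
        obtain ⟨r, rfl⟩ := Submodule.mem_span_singleton.1 hz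
        exact ⟨⟨y, hy⟩, r, rfl⟩
      have hiq : ∀ r : R, r ∈ q ↔ ∃ a, i a = r • (⟨x, hxN'⟩ : ↥(N ⊔ Submodule.span R {x})) := by
        intro r
        rw [hqx']
        exact ⟨fun h => ⟨⟨r • x, h⟩, rfl⟩, fun ⟨a, ha⟩ => by
          have : (a : B) = r • x := congrArg Subtype.val ha
          exact this ▸ a.2⟩
      have key := cls_hom_of_quotient_prime (W := W) i hi _ hix q hq0 hiq
      let g : R →ₗ[R] (↥(N ⊔ Submodule.span R {x}) ⧸ LinearMap.range i) :=
        LinearMap.toSpanSingleton R _ (Submodule.Quotient.mk ⟨x, hxN'⟩)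
      have hg : Function.Surjective g := by
        intro b
        obtain ⟨b, rfl⟩ := Submodule.mkQ_surjective _ b
        obtain ⟨a, r, rfl⟩ := hix b
        refine ⟨r, ?_⟩
        have h0 : (LinearMap.range i).mkQ (i a) = 0 :=
          (Submodule.Quotient.mk_eq_zero _).2 (LinearMap.mem_range_self i a)
        rw [map_add, h0, zero_add]
        rfl
      have hgk : LinearMap.ker g = q := by
        ext r
        rw [hiq, LinearMap.mem_ker]
        change Submodule.Quotient.mk (r • _) = 0 ↔ _
        rw [Submodule.Quotient.mk_eq_zero]
        rfl
      have key2 : cls R ↥(N ⊔ Submodule.span R {x}) = cls R N + cls R (R ⧸ q) := by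
        rw [cls_submodule_add_quotient (LinearMap.range i),
          ← cls_congr (LinearEquiv.ofInjective i hi),
          ← cls_congr (g.quotKerEquivOfSurjective hg), hgk]
      rw [key2, smul_add, ← hcls, key]
      abel
  have e : (⊤ : Submodule R B) ≃ₗ[R] B := Submodule.topEquiv
  rw [← hP.2, cls_congr e, cls_congr (e.congrLeft W R)]

end HomClass

/-! ### Vanishing of Ext in short exact sequences -/

section ExtSequences

variable {R : Type u} [CommRing R] {A B C : Type u} [AddCommGroup A] [AddCommGroup B]
  [AddCommGroup C] [Module R A] [Module R B] [Module R C]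

/-- The vanishing of `Ext^i(X, Y)`. -/
abbrev ExtVanishes (R : Type u) [CommRing R] (X Y : Type u) [AddCommGroup X] [AddCommGroup Y]
    [Module R X] [Module R Y] (i : ℕ) : Prop :=
  Subsingleton (Abelian.Ext (ModuleCat.of R X) (ModuleCat.of R Y) i)

/-- The short complex of modules of a pair of linear maps with composition zero. -/
abbrev shortComplexOfExact (f : A →ₗ[R] B) (g : B →ₗ[R] C) (h : Function.Exact f g) :
    ShortComplex (ModuleCat.{u} R) :=
  ShortComplex.mk (ModuleCat.ofHom f) (ModuleCat.ofHom g)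
    (by ext x; exact h.apply_apply_eq_zero x)

theorem shortExact_shortComplexOfExact (f : A →ₗ[R] B) (g : B →ₗ[R] C)
    (hf : Function.Injective f) (h : Function.Exact f g) (hg : Function.Surjective g) :
    (shortComplexOfExact f g h).ShortExact where
  exact := (ShortComplex.ShortExact.moduleCat_exact_iff_function_exact _).2 h
  mono_f := (ModuleCat.mono_iff_injective _).2 hf
  epi_g := (ModuleCat.epi_iff_surjective _).2 hg

variable (f : A →ₗ[R] B) (g : B →ₗ[R] C)

theorem extVanishes_covariant_left_zero (hf : Function.Injective f) (h : Function.Exact f g)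
    (hg : Function.Surjective g)
    (X : Type u) [AddCommGroup X] [Module R X] (hB : ExtVanishes R X B 0) :
    ExtVanishes R X A 0 := by
  let S := shortComplexOfExact f g h
  have hS : S.ShortExact := shortExact_shortComplexOfExact f g hf h hg
  have : Mono S.f := hS.mono_f
  exact (Abelian.Ext.postcomp_mk₀_injective_of_mono (ModuleCat.of R X) S.f).subsingleton

theorem extVanishes_covariant_left_succ (hf : Function.Injective f) (h : Function.Exact f g)
    (hg : Function.Surjective g)
    (X : Type u) [AddCommGroup X] [Module R X] (i : ℕ) (hB : ExtVanishes R X B (i + 1))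
    (hC : ExtVanishes R X C i) : ExtVanishes R X A (i + 1) := by
  have hS := shortExact_shortComplexOfExact f g hf h hg
  refine subsingleton_of_forall_eq 0 fun x => ?_
  obtain ⟨y, hy⟩ := Abelian.Ext.covariant_sequence_exact₁ _ hS x (Subsingleton.elim _ _) rfl
  rw [← hy, Subsingleton.elim y 0, Abelian.Ext.zero_comp]

theorem extVanishes_covariant_middle (hf : Function.Injective f) (h : Function.Exact f g)
    (hg : Function.Surjective g)
    (X : Type u) [AddCommGroup X] [Module R X] (i : ℕ) (hA : ExtVanishes R X A i)
    (hC : ExtVanishes R X C i) : ExtVanishes R X B i := by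
  have hS := shortExact_shortComplexOfExact f g hf h hg
  refine subsingleton_of_forall_eq 0 fun x => ?_
  obtain ⟨y, hy⟩ := Abelian.Ext.covariant_sequence_exact₂ _ hS x (Subsingleton.elim _ _)
  rw [← hy, Subsingleton.elim y 0, Abelian.Ext.zero_comp]

theorem extVanishes_contravariant_left (hf : Function.Injective f) (h : Function.Exact f g)
    (hg : Function.Surjective g)
    (X : Type u) [AddCommGroup X] [Module R X] (i : ℕ) (hB : ExtVanishes R B X i)
    (hC : ExtVanishes R C X (i + 1)) : ExtVanishes R A X i := by
  have hS := shortExact_shortComplexOfExact f g hf h hg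
  refine subsingleton_of_forall_eq 0 fun x => ?_
  obtain ⟨y, hy⟩ := Abelian.Ext.contravariant_sequence_exact₁ hS _ x (add_comm 1 i)
    (Subsingleton.elim _ _)
  rw [← hy, Subsingleton.elim y 0, Abelian.Ext.comp_zero]

theorem extVanishes_contravariant_middle (hf : Function.Injective f) (h : Function.Exact f g)
    (hg : Function.Surjective g)
    (X : Type u) [AddCommGroup X] [Module R X] (i : ℕ) (hA : ExtVanishes R A X i)
    (hC : ExtVanishes R C X i) : ExtVanishes R B X i := by
  have hS := shortExact_shortComplexOfExact f g hf h hg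
  refine subsingleton_of_forall_eq 0 fun x => ?_
  obtain ⟨y, hy⟩ := Abelian.Ext.contravariant_sequence_exact₂ hS _ x (Subsingleton.elim _ _)
  rw [← hy, Subsingleton.elim y 0, Abelian.Ext.comp_zero]

theorem extVanishes_contravariant_right_succ (hf : Function.Injective f) (h : Function.Exact f g)
    (hg : Function.Surjective g)
    (X : Type u) [AddCommGroup X] [Module R X] (i : ℕ) (hA : ExtVanishes R A X i)
    (hB : ExtVanishes R B X (i + 1)) : ExtVanishes R C X (i + 1) := by
  have hS := shortExact_shortComplexOfExact f g hf h hg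
  refine subsingleton_of_forall_eq 0 fun x => ?_
  obtain ⟨y, hy⟩ := Abelian.Ext.contravariant_sequence_exact₃ hS _ x (Subsingleton.elim _ _)
    (add_comm 1 i)
  rw [← hy, Subsingleton.elim y 0, Abelian.Ext.comp_zero]

theorem exists_comp_eq_of_extVanishes (hf : Function.Injective f) (h : Function.Exact f g)
    (hg : Function.Surjective g)
    (X : Type u) [AddCommGroup X] [Module R X] (hC : ExtVanishes R C X 1) (φ : A →ₗ[R] X) :
    ∃ ψ : B →ₗ[R] X, ψ.comp f = φ := by
  have hS := shortExact_shortComplexOfExact f g hf h hg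
  obtain ⟨y, hy⟩ := Abelian.Ext.contravariant_sequence_exact₁ hS (ModuleCat.of R X)
    (Abelian.Ext.mk₀ (ModuleCat.ofHom φ)) (add_comm 1 0) (Subsingleton.elim _ _)
  obtain ⟨y, rfl⟩ := (Abelian.Ext.mk₀_bijective _ _).2 y
  rw [Abelian.Ext.mk₀_comp_mk₀] at hy
  have := (Abelian.Ext.mk₀_bijective _ _).1 hy
  exact ⟨y.hom, congrArg ModuleCat.Hom.hom this⟩

variable (X : Type u) [AddCommGroup X] [Module R X]

theorem extVanishes_of_free (F : Type u) [AddCommGroup F] [Module R F] [Module.Free R F] (i : ℕ) :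
    ExtVanishes R F X (i + 1) := by
  have : Projective (ModuleCat.of R F) := (IsProjective.iff_projective F).1 inferInstance
  exact Abelian.Ext.subsingleton_of_projective _ _ _

theorem extVanishes_of_subsingleton [Subsingleton A] (i : ℕ) : ExtVanishes R X A i := by
  refine subsingleton_of_forall_eq 0 fun x => ?_
  rw [← x.comp_mk₀_id, (ModuleCat.isZero_of_subsingleton (ModuleCat.of R A)).eq_zero_of_tgt (𝟙 _),
    Abelian.Ext.mk₀_zero, Abelian.Ext.comp_zero]

theorem extVanishes_of_subsingleton_left [Subsingleton A] (i : ℕ) : ExtVanishes R A X i := by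
  refine subsingleton_of_forall_eq 0 fun x => ?_
  rw [← x.mk₀_id_comp, (ModuleCat.isZero_of_subsingleton (ModuleCat.of R A)).eq_zero_of_tgt (𝟙 _),
    Abelian.Ext.mk₀_zero, Abelian.Ext.zero_comp]

theorem extVanishes_congr_left (e : A ≃ₗ[R] B) {i : ℕ} (h : ExtVanishes R B X i) :
    ExtVanishes R A X i :=
  extVanishes_contravariant_left e.toLinearMap (0 : B →ₗ[R] PUnit.{u + 1}) e.injective
    (fun x => by simp) (fun x => ⟨0, Subsingleton.elim _ _⟩) X _ h
    (extVanishes_of_subsingleton_left _ _)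

end ExtSequences

/-! ### Depth through Ext -/

section Depth

open RingTheory.Sequence IsLocalRing

variable {S : Type u} [CommRing S] [IsLocalRing S] [IsNoetherianRing S]

theorem exists_isWeaklyRegular_of_le_depth {S : Type u} [CommRing S] [IsLocalRing S]
    {N : Type u} [AddCommGroup N] [Module S N] {n : ℕ} (hn : 0 < n) (h : (n : ℕ∞) ≤ depth S N) :
    ∃ rs : List S, (∀ r ∈ rs, r ∈ maximalIdeal S) ∧ IsWeaklyRegular N rs ∧ n ≤ rs.length := by
  by_contra! hcon
  have : depth S N ≤ ((n - 1 : ℕ) : ℕ∞) := iSup₂_le fun rs hrs => by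
    have := hcon rs hrs.1 hrs.2
    exact_mod_cast (by omega : rs.length ≤ n - 1)
  have := h.trans this
  rw [Nat.cast_le] at this
  omega

/-- Rees's characterization, which turns depth estimates into long exact sequences. The zero module
is treated apart: sequences of zeros of any length are weakly regular on it. -/
theorem natCast_le_depth_iff (N : Type u) [AddCommGroup N] [Module S N] [Module.Finite S N]
    (n : ℕ) : (n : ℕ∞) ≤ depth S N ↔ ∀ i < n, ExtVanishes S (ResidueField S) N i := by
  have hfin : Module.Finite S (ResidueField S) :=
    inferInstanceAs (Module.Finite S (S ⧸ maximalIdeal S))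
  have hsupp : Module.support S (ResidueField S) = PrimeSpectrum.zeroLocus (maximalIdeal S) := by
    have : Module.support S (S ⧸ maximalIdeal S) = PrimeSpectrum.zeroLocus (maximalIdeal S) := by
      rw [Module.support_eq_zeroLocus, Ideal.annihilator_quotient]
    exact this
  rcases subsingleton_or_nontrivial N with hN | hN
  · refine iff_of_true ?_ fun i _ => extVanishes_of_subsingleton _ i
    refine le_iSup₂_of_le (List.replicate n (0 : S)) ⟨fun r hr => ?_, ⟨fun i hi => ?_⟩⟩ (by simp)
    · rw [List.eq_of_mem_replicate hr]
      exact zero_mem _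
    · exact fun x y _ => Subsingleton.elim _ _
  have hlt : maximalIdeal S • (⊤ : Submodule S N) < ⊤ :=
    (Submodule.top_ne_ideal_smul_of_le_jacobson_annihilator
      (maximalIdeal_le_jacobson _)).symm.lt_top
  constructor
  · intro h
    rcases Nat.eq_zero_or_pos n with rfl | hn
    · simp
    obtain ⟨rs, hrs, hwr, hl⟩ := exists_isWeaklyRegular_of_le_depth hn h
    have hreg : IsRegular N rs := ⟨hwr, by
      intro h
      refine hlt.ne (top_le_iff.1 (h.trans_le (Submodule.smul_mono_left ?_)))
      exact Ideal.span_le.2 fun r hr => hrs r hr⟩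
    intro i hi
    exact ModuleCat.subsingleton_ext_of_exists_isRegular (maximalIdeal S)
      (ModuleCat.of S (ResidueField S)) hsupp.le (ModuleCat.of S N) hlt rs hrs hreg i
      (hi.trans_le hl)
  · intro h
    obtain ⟨rs, hl, hm, hr⟩ := ModuleCat.exists_isRegular_of_exists_subsingleton_ext
      (maximalIdeal S) n (ModuleCat.of S N) hlt (ModuleCat.of S (ResidueField S)) hsupp h
    rw [← hl]
    exact le_iSup₂_of_le rs ⟨hm, hr.1⟩ le_rfl

end Depth

/-! ### Serre's conditions and maximal Cohen-Macaulay modules -/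

section Serre

open IsLocalRing RingTheory.Sequence

variable (R : Type u) [CommRing R]

/-- Serre's condition: `depth M_𝔭 ≥ min (height 𝔭) n` for all primes `𝔭`. -/
def SerreCondition (n : ℕ) (M : Type u) [AddCommGroup M] [Module R M] : Prop :=
  ∀ (p : PrimeSpectrum R) (k : ℕ), k ≤ n → (k : ℕ∞) ≤ p.asIdeal.height →
    (k : ℕ∞) ≤ depth (Localization.AtPrime p.asIdeal) (LocalizedModule p.asIdeal.primeCompl M)

variable {R}
variable {A B C : Type u} [AddCommGroup A] [AddCommGroup B]
  [AddCommGroup C] [Module R A] [Module R B] [Module R C]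

/-- This allows induction on `n`, with one degree gained at each syzygy. -/
theorem isMCM_iff_forall_serreCondition : IsMCM R A ↔ ∀ n, SerreCondition R n A := by
  constructor
  · exact fun h n p k _ hk => hk.trans (h p)
  · intro h p
    refine ENat.forall_natCast_le_iff_le.1 fun k hk => h k p k le_rfl hk

theorem serreCondition_zero : SerreCondition R 0 A := by
  intro p k hk _
  rw [Nat.le_zero.1 hk]
  exact zero_le

theorem localizedModule_map_exact {A B C : Type u} [AddCommGroup A] [AddCommGroup B]
    [AddCommGroup C] [Module R A] [Module R B] [Module R C] (M : Submonoid R) (f : A →ₗ[R] B)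
    (g : B →ₗ[R] C) (h : Function.Exact f g) :
    Function.Exact (LocalizedModule.map M f) (LocalizedModule.map M g) :=
  fun x => LocalizedModule.map_exact M f g h x

variable [IsNoetherianRing R] [Module.Finite R A] [Module.Finite R B] [Module.Finite R C]

theorem serreCondition_iff (n : ℕ) : SerreCondition R n A ↔
    ∀ (p : PrimeSpectrum R) (k : ℕ), k ≤ n → (k : ℕ∞) ≤ p.asIdeal.height → ∀ i < k,
      ExtVanishes (Localization.AtPrime p.asIdeal)
        (ResidueField (Localization.AtPrime p.asIdeal))
        (LocalizedModule p.asIdeal.primeCompl A) i := by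
  refine forall_congr' fun p => ?_
  have : IsNoetherianRing (Localization.AtPrime p.asIdeal) :=
    IsLocalization.isNoetherianRing p.asIdeal.primeCompl _ inferInstance
  have : Module.Finite (Localization.AtPrime p.asIdeal) (LocalizedModule p.asIdeal.primeCompl A) :=
    Module.Finite.of_isLocalizedModule p.asIdeal.primeCompl
      (LocalizedModule.mkLinearMap p.asIdeal.primeCompl A)
  exact forall_congr' fun k => forall_congr' fun _ => forall_congr' fun _ =>
    natCast_le_depth_iff _ _

/-- The depth lemma at each prime: `Ext^(i+1)(k, A)` lies between `Ext^i(k, C)` and `Ext^(i+1)(k,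
B)`. -/
theorem serreCondition_succ_of_exact (f : A →ₗ[R] B) (g : B →ₗ[R] C)
    (hf : Function.Injective f) (h : Function.Exact f g) (hg : Function.Surjective g)
    (n : ℕ) (hB : IsMCM R B) (hC : SerreCondition R n C) :
    SerreCondition R (n + 1) A := by
  rw [serreCondition_iff] at hC ⊢
  intro p k hk hkh i hi
  have hB' := (serreCondition_iff k).1 (isMCM_iff_forall_serreCondition.1 hB k) p k le_rfl hkh
  have h1 := LocalizedModule.map_injective p.asIdeal.primeCompl f hf
  have h2 := localizedModule_map_exact p.asIdeal.primeCompl f g h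
  have h3 := LocalizedModule.map_surjective p.asIdeal.primeCompl g hg
  cases i with
  | zero => exact extVanishes_covariant_left_zero _ _ h1 h2 h3 _ (hB' 0 hi)
  | succ i =>
    refine extVanishes_covariant_left_succ _ _ h1 h2 h3 _ i (hB' _ hi)
      (hC p (k - 1) (by omega) (le_trans ?_ hkh) i (by omega))
    exact_mod_cast Nat.sub_le k 1

theorem isMCM_of_exact_left (f : A →ₗ[R] B) (g : B →ₗ[R] C)
    (hf : Function.Injective f) (h : Function.Exact f g) (hg : Function.Surjective g)
    (hB : IsMCM R B) (hC : IsMCM R C) : IsMCM R A := by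
  rw [isMCM_iff_forall_serreCondition] at hC ⊢
  intro n
  cases n with
  | zero => exact serreCondition_zero
  | succ n => exact serreCondition_succ_of_exact f g hf h hg n hB (hC n)

theorem isMCM_of_exact_middle (f : A →ₗ[R] B) (g : B →ₗ[R] C)
    (hf : Function.Injective f) (h : Function.Exact f g) (hg : Function.Surjective g)
    (hA : IsMCM R A) (hC : IsMCM R C) : IsMCM R B := by
  rw [isMCM_iff_forall_serreCondition] at hA hC ⊢
  intro n
  rw [serreCondition_iff]
  intro p k hk hkh i hi
  exact extVanishes_covariant_middle _ _
    (LocalizedModule.map_injective p.asIdeal.primeCompl f hf)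
    (localizedModule_map_exact p.asIdeal.primeCompl f g h)
    (LocalizedModule.map_surjective p.asIdeal.primeCompl g hg) _ i
    ((serreCondition_iff n).1 (hA n) p k hk hkh i hi)
    ((serreCondition_iff n).1 (hC n) p k hk hkh i hi)

theorem isMCM_of_subsingleton [Subsingleton A] : IsMCM R A := by
  rw [isMCM_iff_forall_serreCondition]
  intro n
  rw [serreCondition_iff]
  intro p k hk hkh i hi
  have : Subsingleton (LocalizedModule p.asIdeal.primeCompl A) := by
    rw [LocalizedModule.subsingleton_iff]
    exact fun a => ⟨1, Submonoid.one_mem _, Subsingleton.elim _ _⟩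
  exact extVanishes_of_subsingleton _ i

theorem isMCM_congr (e : A ≃ₗ[R] B) (hA : IsMCM R A) : IsMCM R B :=
  isMCM_of_exact_middle (C := PUnit.{u + 1}) e.toLinearMap 0 e.injective
    (fun x => by simp) (fun x => ⟨0, Subsingleton.elim _ _⟩) hA isMCM_of_subsingleton

theorem isMCM_prod (hA : IsMCM R A) (hB : IsMCM R B) : IsMCM R (A × B) :=
  isMCM_of_exact_middle (LinearMap.inl R A B) (LinearMap.snd R A B) LinearMap.inl_injective
    (LinearMap.exact_iff.2 (by rw [LinearMap.ker_snd])) LinearMap.snd_surjective hA hB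

theorem isMCM_fin_fun (hA : IsMCM R A) (n : ℕ) : IsMCM R (Fin n → A) := by
  induction n with
  | zero => exact isMCM_of_subsingleton
  | succ n ih =>
    exact isMCM_congr (Fin.consLinearEquiv R (fun _ : Fin (n + 1) => A)) (isMCM_prod hA ih)

/-- A maximal Cohen-Macaulay module over a domain is torsion-free. -/
theorem IsMCM.isTorsionFree [IsDomain R] {A : Type u} [AddCommGroup A] [Module R A]
    (hA : IsMCM R A) : Module.IsTorsionFree R A := by
  have key : ∀ (r : R) (a : A), r ≠ 0 → r • a = 0 → a = 0 := by
    intro r a hr hra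
    by_contra ha
    obtain ⟨P, hP, haP⟩ := exists_le_isAssociatedPrime_of_isNoetherianRing R a ha
    rw [isAssociatedPrime_iff] at hP
    obtain ⟨hPp, b, hb⟩ := hP
    have hPb : ∀ s, s ∈ P ↔ s • b = 0 := fun s => by
      rw [hb, Submodule.mem_colon_singleton, Submodule.mem_bot]
    have hrP : r ∈ P := haP (by rwa [Submodule.mem_colon_singleton, Submodule.mem_bot])
    have hht : ((1 : ℕ) : ℕ∞) ≤ P.height := by
      rw [Nat.cast_one, Order.one_le_iff_ne_zero, Ne, Ideal.height_eq_zero_iff_eq_bot]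
      rintro rfl
      exact hr hrP
    -- The localization at `P` has positive depth, yet `P` annihilates `b`: the first element `y` of
    -- a regular sequence kills `b / 1`, so `b / 1 = 0`, and some element outside `P` kills `b`.
    obtain ⟨rs, hrs, hwr, hl⟩ := exists_isWeaklyRegular_of_le_depth one_pos
      (hht.trans (hA ⟨P, hPp⟩))
    match rs, hrs, hwr, hl with
    | y :: rs, hrs, hwr, _ =>
      have hy := hrs y List.mem_cons_self
      have hreg := ((isWeaklyRegular_cons_iff _ _ _).1 hwr).1
      have hyb : y • LocalizedModule.mkLinearMap P.primeCompl A b = 0 := by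
        obtain ⟨⟨c, d⟩, rfl⟩ := IsLocalization.mk'_surjective P.primeCompl y
        have hc : c ∈ P := (IsLocalization.AtPrime.mk'_mem_maximal_iff _ P c d).1 hy
        change IsLocalization.mk' _ c d • LocalizedModule.mk b 1 = _
        rw [← Localization.mk_eq_mk', LocalizedModule.mk_smul_mk, (hPb c).1 hc,
          LocalizedModule.zero_mk]
      have hb0 : LocalizedModule.mkLinearMap P.primeCompl A b = 0 :=
        hreg (hyb.trans (smul_zero y).symm)
      obtain ⟨s, hs⟩ := (IsLocalizedModule.eq_zero_iff P.primeCompl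
        (LocalizedModule.mkLinearMap P.primeCompl A)).1 hb0
      exact s.2 ((hPb s).2 hs)
  refine ⟨fun {r} hr x y hxy => ?_⟩
  exact sub_eq_zero.1 (key r _ hr.ne_zero (by rw [smul_sub, sub_eq_zero]; exact hxy))

end Serre

/-! ### Ext into a module of finite injective dimension -/

section LocalExt

open scoped Pointwise
open IsLocalRing RingTheory.Sequence

variable {R : Type u} [CommRing R] [IsLocalRing R]

/-- Localizing a local ring at its maximal ideal changes nothing, so a regular sequence there comes
from `R`. -/
theorem exists_isWeaklyRegular_of_isMCM {N : Type u} [AddCommGroup N] [Module R N]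
    (h : IsMCM R N) {n : ℕ} (hn : (n : ℕ∞) ≤ (maximalIdeal R).height) :
    ∃ rs : List R, (∀ r ∈ rs, r ∈ maximalIdeal R) ∧ IsWeaklyRegular N rs ∧ n ≤ rs.length := by
  rcases Nat.eq_zero_or_pos n with rfl | hn0
  · exact ⟨[], by simp, IsWeaklyRegular.nil R N, le_rfl⟩
  obtain ⟨rs, hrs, hwr, hl⟩ := exists_isWeaklyRegular_of_le_depth hn0
    (hn.trans (h ⟨maximalIdeal R, inferInstance⟩))
  have hunit : ∀ s : (maximalIdeal R).primeCompl, IsUnit (s : R) := fun s => by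
    by_contra hs
    exact s.2 ((mem_maximalIdeal _).2 hs)
  have hsurj : Function.Surjective (algebraMap R (Localization.AtPrime (maximalIdeal R))) := by
    intro x
    obtain ⟨a, s, rfl⟩ := IsLocalization.exists_mk'_eq (maximalIdeal R).primeCompl x
    obtain ⟨v, hv⟩ := hunit s
    refine ⟨a * ↑v⁻¹, ?_⟩
    rw [IsLocalization.eq_mk'_iff_mul_eq, ← map_mul, ← hv, mul_assoc, Units.inv_mul, mul_one]
  obtain ⟨inv, hinv⟩ := hsurj.hasRightInverse
  have hrs' : (rs.map inv).map (algebraMap R (Localization.AtPrime (maximalIdeal R))) = rs := by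
    rw [List.map_map]
    exact (List.map_congr_left fun r _ => hinv r).trans (List.map_id rs)
  have hbij : Function.Bijective (LocalizedModule.mkLinearMap (maximalIdeal R).primeCompl N) := by
    constructor
    · rw [← LinearMap.ker_eq_bot, LinearMap.ker_eq_bot']
      intro a ha
      obtain ⟨s, hs⟩ := (IsLocalizedModule.eq_zero_iff (maximalIdeal R).primeCompl _).1 ha
      exact (hunit s).smul_eq_zero.1 hs
    · intro x
      obtain ⟨⟨a, s⟩, rfl⟩ := IsLocalizedModule.mk'_surjective (maximalIdeal R).primeCompl
        (LocalizedModule.mkLinearMap (maximalIdeal R).primeCompl N) x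
      obtain ⟨v, hv⟩ := hunit s
      refine ⟨(↑v⁻¹ : R) • a, ?_⟩
      rw [Function.uncurry_apply_pair, eq_comm, IsLocalizedModule.mk'_eq_iff]
      rw [Submonoid.smul_def, ← map_smul, ← hv, smul_smul, Units.mul_inv, one_smul]
  refine ⟨rs.map inv, fun r hr => ?_, ?_, by simpa using hl⟩
  · obtain ⟨x, hx, rfl⟩ := List.mem_map.1 hr
    have := hrs x hx
    rw [← hinv x] at this
    exact (IsLocalization.AtPrime.to_map_mem_maximal_iff _ (maximalIdeal R) _).1 this
  · rw [(LinearEquiv.ofBijective _ hbij).isWeaklyRegular_congr,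
      ← isWeaklyRegular_map_algebraMap_iff (Localization.AtPrime (maximalIdeal R)), hrs']
    exact hwr

variable [IsNoetherianRing R] {W : Type u} [AddCommGroup W] [Module R W]

/-- Multiplication by `x` is surjective on the finitely generated module `Ext^i(N, W)`, so
Nakayama's lemma applies. -/
theorem extVanishes_of_quotSMulTop [Module.Finite R W] {N : Type u} [AddCommGroup N] [Module R N]
    [Module.Finite R N] {x : R} (hx : x ∈ maximalIdeal R) (hreg : IsSMulRegular N x) (i : ℕ)
    (h : ExtVanishes R (QuotSMulTop x N) W (i + 1)) : ExtVanishes R N W i := by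
  have hS := shortExact_shortComplexOfExact (LinearMap.lsmul R N x)
    (Submodule.mkQ (x • (⊤ : Submodule R N))) hreg
    (LinearMap.exact_lsmul_mkQ_smul_top N x) (Submodule.mkQ_surjective _)
  have key : (⊤ : Submodule R (Abelian.Ext (ModuleCat.of R N) (ModuleCat.of R W) i)) ≤
      maximalIdeal R • ⊤ := by
    rintro y -
    have h' : Subsingleton (Abelian.Ext (ModuleCat.of R (N ⧸ x • (⊤ : Submodule R N)))
      (ModuleCat.of R W) (i + 1)) := h
    obtain ⟨z, hz⟩ := Abelian.Ext.contravariant_sequence_exact₁ hS _ y (add_comm 1 i)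
      (h'.elim _ _)
    change (Abelian.Ext.mk₀ (x • 𝟙 (ModuleCat.of R N))).comp z (zero_add i) = y at hz
    rw [Abelian.Ext.mk₀_smul, Abelian.Ext.smul_comp, Abelian.Ext.mk₀_id_comp] at hz
    rw [← hz]
    exact Submodule.smul_mem_smul hx trivial
  have := Submodule.eq_bot_of_le_smul_of_le_jacobson_bot _ _ (Module.Finite.fg_top) key
    (maximalIdeal_le_jacobson _)
  exact (Submodule.subsingleton_iff R).1 (subsingleton_of_bot_eq_top this.symm)

theorem extVanishes_of_isWeaklyRegular [Module.Finite R W] {n : ℕ}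
    (hn : ∀ (X : Type u) [AddCommGroup X] [Module R X] [Module.Finite R X] (i : ℕ), n < i →
      ExtVanishes R X W i) (rs : List R) :
    ∀ (N : Type u) [AddCommGroup N] [Module R N] [Module.Finite R N],
      (∀ r ∈ rs, r ∈ maximalIdeal R) → IsWeaklyRegular N rs → ∀ i, n < i + rs.length →
      ExtVanishes R N W i := by
  induction rs with
  | nil => exact fun N _ _ _ _ _ i hi => hn N i hi
  | cons x rs ih =>
    intro N _ _ _ hrs hwr i hi
    rw [isWeaklyRegular_cons_iff] at hwr
    refine extVanishes_of_quotSMulTop (hrs x List.mem_cons_self) hwr.1 i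
      (ih _ (fun r hr => hrs r (List.mem_cons_of_mem _ hr)) hwr.2 (i + 1) ?_)
    rw [List.length_cons] at hi
    omega

/-- Dividing by a regular element lowers the dimension by one and raises the bound for vanishing by
one. For `N = R` and a maximal regular sequence this yields a test module of dimension zero. -/
theorem exists_quotient_extVanishes (rs : List R) :
    ∀ (N : Type u) [AddCommGroup N] [Module R N] [Module.Finite R N] [Nontrivial N] (e : ℕ),
      (∀ r ∈ rs, r ∈ maximalIdeal R) → IsWeaklyRegular N rs →
      (∀ i, e < i → ExtVanishes R N W i) →
      ∃ (A : Type u) (_ : AddCommGroup A) (_ : Module R A) (_ : Module.Finite R A),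
        Nontrivial A ∧ Module.supportDim R A + rs.length = Module.supportDim R N ∧
        ∀ i, e + rs.length < i → ExtVanishes R A W i := by
  induction rs with
  | nil => exact fun N _ _ _ hN e _ _ h => ⟨N, _, _, inferInstance, hN, by simp, h⟩
  | cons x rs ih =>
    intro N _ _ _ hN e hrs hwr h
    rw [isWeaklyRegular_cons_iff] at hwr
    have hx := hrs x List.mem_cons_self
    have : Nontrivial (QuotSMulTop x N) := nontrivial_quotSMulTop_of_mem_maximalIdeal N hx
    obtain ⟨A, _, _, _, hA, hdim, hext⟩ := ih (QuotSMulTop x N) (e + 1)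
      (fun r hr => hrs r (List.mem_cons_of_mem _ hr)) hwr.2 (by
        intro i hi
        obtain ⟨j, rfl⟩ : ∃ j, i = j + 1 := ⟨i - 1, by omega⟩
        exact extVanishes_contravariant_right_succ (LinearMap.lsmul R N x) _ hwr.1
          (LinearMap.exact_lsmul_mkQ_smul_top N x)
          (Submodule.mkQ_surjective _) W j (h j (by omega)) (h (j + 1) (by omega)))
    refine ⟨A, _, _, inferInstance, hA, ?_, fun i hi => hext i ?_⟩
    · rw [← Module.supportDim_quotSMulTop_succ_eq_supportDim hwr.1 hx, ← hdim, List.length_cons,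
        Nat.cast_add, Nat.cast_one, add_assoc]
    · rw [List.length_cons] at hi
      omega

/-- In dimension at most zero an associated prime cannot lie strictly below the maximal ideal. -/
theorem exists_residueField_injective {A : Type u} [AddCommGroup A] [Module R A]
    [Module.Finite R A] [Nontrivial A] (h : Module.supportDim R A ≤ 0) :
    ∃ f : ResidueField R →ₗ[R] A, Function.Injective f := by
  obtain ⟨P, hP⟩ := associatedPrimes.nonempty R A
  have hPs := AssociatedPrimes.mem_iff.1 hP
  rw [isAssociatedPrime_iff] at hPs
  obtain ⟨hPp, a, ha⟩ := hPs
  have hPa : ∀ s, s ∈ P ↔ s • a = 0 := fun s => by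
    rw [ha, Submodule.mem_colon_singleton, Submodule.mem_bot]
  have hPm : P = maximalIdeal R := by
    by_contra hne
    have hlt : P < maximalIdeal R := lt_of_le_of_ne (le_maximalIdeal hPp.ne_top) hne
    have h1 : (⟨P, hPp⟩ : PrimeSpectrum R) ∈ Module.support R A := by
      rw [Module.mem_support_iff_exists_annihilator]
      exact ⟨a, fun s hs => (hPa s).2 ((Submodule.mem_annihilator_span_singleton _ _).1 hs)⟩
    have h2 : (⟨maximalIdeal R, inferInstance⟩ : PrimeSpectrum R) ∈ Module.support R A :=
      Module.mem_support_mono hlt.le h1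
    have hlt' : (⟨_, h1⟩ : Module.support R A) < ⟨_, h2⟩ := hlt
    have := (Order.one_le_krullDim_iff.2 ⟨_, _, hlt'⟩).trans h
    exact absurd this (by decide)
  have hker : LinearMap.ker (LinearMap.toSpanSingleton R A a) = maximalIdeal R := by
    ext s
    rw [← hPm, hPa]
    rfl
  let f : (R ⧸ maximalIdeal R) →ₗ[R] A :=
    Submodule.liftQ (maximalIdeal R) (LinearMap.toSpanSingleton R A a) hker.ge
  exact ⟨f, LinearMap.ker_eq_bot.1 (Submodule.ker_liftQ_eq_bot _ _ _ hker.le)⟩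

/-- The vanishing of the highest `Ext^n(-, W)` for `n` greater than the depth of `R`. -/
theorem extVanishes_of_residueField [Module.Finite R W] {n : ℕ}
    (hn : ∀ (X : Type u) [AddCommGroup X] [Module R X] [Module.Finite R X],
      ExtVanishes R X W (n + 1)) (hk : ExtVanishes R (ResidueField R) W n)
    (X : Type u) [AddCommGroup X] [Module R X] [hX : Module.Finite R X] :
    ExtVanishes R X W n := by
  refine IsNoetherianRing.induction_on_isQuotientEquivQuotientPrime R hX
    (motive := fun N _ _ _ => ExtVanishes R N W n) ?_ ?_ ?_
  · intro N _ _ _ _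
    exact extVanishes_of_subsingleton_left _ n
  · intro N _ _ _ p e
    refine extVanishes_congr_left _ e ?_
    by_cases hp : p.asIdeal = maximalIdeal R
    · rw [hp]
      exact hk
    -- For `p ≠ 𝔪`, an `x ∈ 𝔪` outside `p` is regular on `R / p`, so vanishing in degree `n + 1`
    -- descends to degree `n`.
    · obtain ⟨x, hx, hxp⟩ := Set.not_subset.1 (fun h => hp
        (le_antisymm (le_maximalIdeal p.2.ne_top) h))
      refine extVanishes_of_quotSMulTop hx (fun a b hab => ?_) n (hn _)
      have hx0 : Ideal.Quotient.mk p.asIdeal x ≠ 0 := fun h =>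
        hxp (Ideal.Quotient.eq_zero_iff_mem.1 h)
      have hab' : Ideal.Quotient.mk p.asIdeal x * a = Ideal.Quotient.mk p.asIdeal x * b := by
        simpa only [Algebra.smul_def, Ideal.Quotient.algebraMap_eq] using hab
      exact mul_left_cancel₀ hx0 hab'
  · intro A _ _ _ B _ _ _ C _ _ _ f g hf hg hfg hA hC
    exact extVanishes_contravariant_middle f g hf hfg hg W n hA hC

/-- If `W` has finite injective dimension over the Cohen-Macaulay ring `R`, then
`Ext^i(N, W) = 0` for all `i > 0` and all maximal Cohen-Macaulay modules `N`. -/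
theorem extVanishes_of_isMCM [Module.Finite R W] (hR : IsCohenMacaulay R) (hW : FiniteInjDim R W)
    (N : Type u) [AddCommGroup N] [Module R N] [Module.Finite R N] (hN : IsMCM R N)
    (i : ℕ) (hi : 0 < i) : ExtVanishes R N W i := by
  obtain ⟨h, hh⟩ := ENat.ne_top_iff_exists.1 (maximalIdeal R).height_lt_top_of_isPrime.ne
  obtain ⟨rs, hrs, hwr, hl⟩ := exists_isWeaklyRegular_of_isMCM hR hh.le
  obtain ⟨A, _, _, _, hA, hdim, hext⟩ := exists_quotient_extVanishes (W := W) rs R 0 hrs hwr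
    (fun i hi => by
      obtain ⟨j, rfl⟩ : ∃ j, i = j + 1 := ⟨i - 1, by omega⟩
      exact extVanishes_of_free _ _ _)
  have hdimA : Module.supportDim R A + rs.length = h := by
    rw [hdim, Module.supportDim_self_eq_ringKrullDim,
      ← IsLocalRing.maximalIdeal_height_eq_ringKrullDim, ← hh]
    rfl
  obtain ⟨m, hm⟩ : ∃ m : ℕ, Module.supportDim R A = m := by
    generalize Module.supportDim R A = D at hdimA
    cases D with
    | bot => simp at hdimA
    | coe D =>
      cases D with
      | top => exact absurd hdimA (by exact_mod_cast (by simp))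
      | coe D => exact ⟨D, rfl⟩
  have hml : m + rs.length = h := by
    rw [hm] at hdimA
    exact_mod_cast hdimA
  obtain ⟨f, hf⟩ := exists_residueField_injective (A := A) (by
    rw [hm]
    have : m = 0 := by omega
    rw [this]
    rfl)
  -- The injective dimension bound `n` is lowered to `h = dim R` by descending induction. With `k ⊆
  -- A`, `Ext^i(k, W)` sits between `Ext^i(A, W)`, zero for `i > h`, and `Ext^(i+1)(A / k, W)`, zero
  -- by induction.
  have hbound : ∀ (X : Type u) [AddCommGroup X] [Module R X] [Module.Finite R X] (i : ℕ), h < i →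
      ExtVanishes R X W i := by
    obtain ⟨n, hn⟩ := hW
    have key : ∀ k : ℕ, ∀ (X : Type u) [AddCommGroup X] [Module R X] [Module.Finite R X] (i : ℕ),
        h < i → n < i + k → ExtVanishes R X W i := by
      intro k
      induction k with
      | zero =>
        intro X _ _ _ i _ hi
        exact HasInjectiveDimensionLT.subsingleton (ModuleCat.of R W) (n + 1) i hi _
      | succ k ih =>
        intro X _ _ _ i hhi hi
        have hsucc : ∀ (X : Type u) [AddCommGroup X] [Module R X] [Module.Finite R X],
            ExtVanishes R X W (i + 1) := fun X _ _ _ => ih X (i + 1) (by omega) (by omega)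
        refine extVanishes_of_residueField hsucc ?_ X
        exact extVanishes_contravariant_left f (LinearMap.range f).mkQ hf
          (LinearMap.exact_map_mkQ_range f) (Submodule.mkQ_surjective _) W i
          (hext i (by omega)) (hsucc _)
    exact fun X _ _ _ i hi => key (n + 1) X i hi (by omega)
  -- A regular sequence of length at least `h` on `N` lowers the bound from `h` to zero.
  obtain ⟨rs', hrs', hwr', hl'⟩ := exists_isWeaklyRegular_of_isMCM hN hh.le
  exact extVanishes_of_isWeaklyRegular hbound rs' N hrs' hwr' i (by omega)

end LocalExt

/-! ### Syzygies and duals that are maximal Cohen-Macaulay -/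

section Syzygies

variable {R : Type u} [CommRing R]

theorem exact_subtype_ker {A B : Type*} [AddCommGroup A] [AddCommGroup B] [Module R A] [Module R B]
    (f : A →ₗ[R] B) : Function.Exact (LinearMap.ker f).subtype f :=
  LinearMap.exact_subtype_ker_map f

theorem SerreCondition.isMCM [IsLocalRing R] {N : Type u} [AddCommGroup N] [Module R N]
    {n : ℕ} (h : SerreCondition R n N)
    (hn : (IsLocalRing.maximalIdeal R).height ≤ n) : IsMCM R N := by
  intro p
  have hp : p.asIdeal.height ≤ n :=
    (Ideal.height_mono (IsLocalRing.le_maximalIdeal p.2.ne_top)).trans hn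
  obtain ⟨k, hk⟩ := ENat.ne_top_iff_exists.1 (hp.trans_lt (ENat.natCast_lt_top n)).ne
  rw [← hk] at hp ⊢
  exact h p k (by exact_mod_cast hp) hk.le

variable [IsNoetherianRing R]

theorem isMCM_fun (hR : IsCohenMacaulay R) (n : ℕ) : IsMCM R (Fin n → R) :=
  isMCM_fin_fun hR n

variable {W : Type u} [AddCommGroup W] [Module R W] [Module.Finite R W]

/-- Over a Cohen-Macaulay ring, `Hom(N, W)` is maximal Cohen-Macaulay if `W` is, and if
`Ext^i(N, W) = 0` for all `i > 0`. -/
theorem isMCM_hom_of_extVanishes (hW : IsMCM R W) {N : Type u} [AddCommGroup N] [Module R N]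
    [Module.Finite R N] (hN : ∀ i, 0 < i → ExtVanishes R N W i) : IsMCM R (N →ₗ[R] W) := by
  rw [isMCM_iff_forall_serreCondition]
  intro n
  induction n generalizing N with
  | zero => exact serreCondition_zero
  | succ n ih =>
    obtain ⟨b, π, hπ⟩ := Module.Finite.exists_fin' R N
    have hK : ∀ i, 0 < i → ExtVanishes R (LinearMap.ker π) W i := by
      intro i hi
      obtain ⟨i, rfl⟩ := Nat.exists_eq_succ_of_ne_zero hi.ne'
      exact extVanishes_contravariant_left _ π (LinearMap.ker π).injective_subtype
        (exact_subtype_ker π) hπ W _ (extVanishes_of_free _ _ _) (hN _ (by omega))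
    -- Since `Ext¹(N, W) = 0`, the sequence `0 → Hom(N, W) → W^b → Hom(ker π, W) → 0` is exact, and
    -- `ker π` inherits the vanishing of Ext.
    refine serreCondition_succ_of_exact (LinearMap.lcomp R W π)
      (LinearMap.lcomp R W (LinearMap.ker π).subtype)
      (LinearMap.lcomp_injective_of_surjective _ hπ)
      (LinearMap.exact_lcomp_of_exact_of_surjective _ (exact_subtype_ker π) hπ) ?_ n
      (isMCM_congr ((Pi.basisFun R (Fin b)).constr R) (isMCM_fin_fun hW b)) (ih hK)
    intro φ
    exact exists_comp_eq_of_extVanishes _ π (LinearMap.ker π).injective_subtype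
      (exact_subtype_ker π) hπ W (hN 1 one_pos) φ

/-- `K` is an `n`-th syzygy: each step gains one degree in Serre's condition and changes the sign of
the class modulo `ℝ[R]`. -/
theorem exists_cls_eq_of_serreCondition (hR : IsCohenMacaulay R) (n : ℕ) (N : Type u)
    [AddCommGroup N] [Module R N] [Module.Finite R N] :
    ∃ (K : Type u) (_ : AddCommGroup K) (_ : Module R K) (_ : Module.Finite R K),
      SerreCondition R n K ∧ ∃ a : ℝ, cls R N = a • cls R R + (-1 : ℝ) ^ n • cls R K := by
  induction n with
  | zero => exact ⟨N, _, _, inferInstance, serreCondition_zero, 0, by simp⟩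
  | succ n ih =>
    obtain ⟨K, _, _, _, hK, a, ha⟩ := ih
    obtain ⟨b, π, hπ⟩ := Module.Finite.exists_fin' R K
    have hcls := cls_of_exact _ π (LinearMap.ker π).injective_subtype (exact_subtype_ker π) hπ
    refine ⟨LinearMap.ker π, _, _, inferInstance, serreCondition_succ_of_exact _ π
      (LinearMap.ker π).injective_subtype (exact_subtype_ker π) hπ n (isMCM_fun hR b) hK,
      a + (-1) ^ n * b, ?_⟩
    rw [cls_fin_fun] at hcls
    rw [ha, eq_sub_of_add_eq' hcls.symm, pow_succ]
    module

variable [IsLocalRing R]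

theorem exists_isMCM_cls_eq_add (hR : IsCohenMacaulay R) (N : Type u)
    [AddCommGroup N] [Module R N] [Module.Finite R N] :
    ∃ (K : Type u) (_ : AddCommGroup K) (_ : Module R K) (_ : Module.Finite R K),
      IsMCM R K ∧ ∃ a : ℝ, cls R N = a • cls R R + cls R K := by
  obtain ⟨h, hh⟩ := ENat.ne_top_iff_exists.1
    (IsLocalRing.maximalIdeal R).height_lt_top_of_isPrime.ne
  -- The even number `2 * h` gives the sign `+` and is at least the dimension.
  obtain ⟨K, _, _, _, hK, a, ha⟩ := exists_cls_eq_of_serreCondition hR (2 * h) N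
  refine ⟨K, _, _, inferInstance, hK.isMCM ?_, a, by simpa using ha⟩
  rw [← hh]
  exact_mod_cast (by omega : h ≤ 2 * h)

theorem exists_isMCM_cls_eq_sub (hR : IsCohenMacaulay R) (N : Type u)
    [AddCommGroup N] [Module R N] [Module.Finite R N] :
    ∃ (K : Type u) (_ : AddCommGroup K) (_ : Module R K) (_ : Module.Finite R K),
      IsMCM R K ∧ ∃ a : ℝ, cls R N = a • cls R R - cls R K := by
  obtain ⟨b, π, hπ⟩ := Module.Finite.exists_fin' R N
  have hcls := cls_of_exact _ π (LinearMap.ker π).injective_subtype (exact_subtype_ker π) hπ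
  obtain ⟨K, _, _, _, hK, a, ha⟩ := exists_isMCM_cls_eq_add hR (LinearMap.ker π)
  refine ⟨K, _, _, inferInstance, hK, b - a, ?_⟩
  rw [cls_fin_fun, ha] at hcls
  rw [eq_sub_of_add_eq' hcls.symm]
  module

theorem isMCM_hom (hR : IsCohenMacaulay R) (hW : IsMCM R W) (hWi : FiniteInjDim R W)
    {N : Type u} [AddCommGroup N] [Module R N] [Module.Finite R N] (hN : IsMCM R N) :
    IsMCM R (N →ₗ[R] W) :=
  isMCM_hom_of_extVanishes hW fun i hi => extVanishes_of_isMCM hR hWi N hN i hi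

end Syzygies

/-! ### The class of `R` as an order unit of the cone -/

section Cone

variable {R : Type u} [CommRing R]

instance : ContinuousAdd (HR R) := IsModuleTopology.toContinuousAdd ℝ (HR R)

theorem cls_mem_c {M : Type u} [AddCommGroup M] [Module R M] [Module.Finite R M] (hM : IsMCM R M) :
    cls R M ∈ c R :=
  Submodule.subset_span ⟨M, _, _, inferInstance, hM, rfl⟩

theorem smul_mem_c {x : HR R} (hx : x ∈ c R) {a : ℝ} (ha : 0 ≤ a) : a • x ∈ c R :=
  (c R).smul_mem ha hx

variable [IsNoetherianRing R] [IsLocalRing R]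

/-- Modulo `ℝ[R]`, both `[N]` and `-[N]` are classes of maximal Cohen-Macaulay modules, and the
classes `[N]` span. -/
theorem exists_smul_cls_add_mem_c (hR : IsCohenMacaulay R) (x : HR R) :
    ∃ a : ℝ, 0 ≤ a ∧ a • cls R R + x ∈ c R ∧ a • cls R R - x ∈ c R := by
  have hx : x ∈ Submodule.span ℝ {x : HR R | ∃ (M : Type u) (_ : AddCommGroup M) (_ : Module R M)
      (_ : Module.Finite R M), x = cls R M} := by
    rw [span_range_cls]
    trivial
  have hRc : cls R R ∈ c R := cls_mem_c hR
  induction hx using Submodule.span_induction with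
  | mem x hx =>
    obtain ⟨N, _, _, _, rfl⟩ := hx
    obtain ⟨K, _, _, _, hK, a, ha⟩ := exists_isMCM_cls_eq_add hR N
    obtain ⟨K', _, _, _, hK', a', ha'⟩ := exists_isMCM_cls_eq_sub hR N
    refine ⟨|a| + |a'|, by positivity, ?_, ?_⟩
    · have e : (|a| + |a'|) • cls R R + cls R N =
          (|a| + a + |a'|) • cls R R + cls R K := by
        rw [ha]
        module
      rw [e]
      refine add_mem (smul_mem_c hRc ?_) (cls_mem_c hK)
      linarith [neg_abs_le a, abs_nonneg a']
    · have e : (|a| + |a'|) • cls R R - cls R N =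
          (|a'| - a' + |a|) • cls R R + cls R K' := by
        rw [ha']
        module
      rw [e]
      refine add_mem (smul_mem_c hRc ?_) (cls_mem_c hK')
      linarith [le_abs_self a', abs_nonneg a]
  | zero => exact ⟨0, le_rfl, by simp, by simp⟩
  | add x y _ _ hx hy =>
    obtain ⟨a, ha, h1, h2⟩ := hx
    obtain ⟨b, hb, h3, h4⟩ := hy
    refine ⟨a + b, by positivity, ?_, ?_⟩
    · convert add_mem h1 h3 using 1
      module
    · convert add_mem h2 h4 using 1
      module
  | smul t x _ hx =>
    obtain ⟨a, ha, h1, h2⟩ := hx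
    refine ⟨|t| * a, by positivity, ?_⟩
    rcases le_total 0 t with ht | ht
    · rw [abs_of_nonneg ht, mul_smul, ← smul_add, ← smul_sub]
      exact ⟨smul_mem_c h1 ht, smul_mem_c h2 ht⟩
    · have e1 : |t| • (a • cls R R - x) = (|t| * a) • cls R R + t • x := by
        rw [abs_of_nonpos ht]
        module
      have e2 : |t| • (a • cls R R + x) = (|t| * a) • cls R R - t • x := by
        rw [abs_of_nonpos ht]
        module
      rw [← e1, ← e2]
      exact ⟨smul_mem_c h2 (abs_nonneg t), smul_mem_c h1 (abs_nonneg t)⟩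

theorem mem_interior_c (hR : IsCohenMacaulay R) [Module.Finite ℝ (HR R)] {x y : HR R} {ε : ℝ}
    (hε : 0 < ε) (hy : y ∈ c R) (hx : x = ε • cls R R + y) :
    x ∈ interior (c R : Set (HR R)) := by
  have hRc : cls R R ∈ c R := cls_mem_c hR
  let b := Module.finBasis ℝ (HR R)
  choose a ha h1 h2 using fun i => exists_smul_cls_add_mem_c hR (b i)
  have hcont : ∀ i, Continuous fun z => b.repr z i := fun i =>
    IsModuleTopology.continuous_of_linearMap (b.coord i)
  rw [mem_interior]
  -- Moving by `±b i` costs `a i` copies of `[R]`; in this neighbourhood the total cost stays below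
  -- the available `ε`.
  refine ⟨{z | ∑ i, |b.repr z i - b.repr x i| * a i < ε}, ?_, ?_, ?_⟩
  · intro z hz
    have e1 : z = x + ∑ i, (b.repr z i - b.repr x i) • b i := by
      conv_lhs => rw [← sub_add_cancel z x, ← b.sum_repr (z - x), add_comm]
      simp only [map_sub, Finsupp.sub_apply]
    have e2 : z = y + (ε - ∑ i, |b.repr z i - b.repr x i| * a i) • cls R R +
        ∑ i, ((|b.repr z i - b.repr x i| * a i) • cls R R +
          (b.repr z i - b.repr x i) • b i) := by
      rw [Finset.sum_add_distrib, ← Finset.sum_smul]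
      refine e1.trans ?_
      generalize ∑ i, (b.repr z i - b.repr x i) • b i = u
      generalize ∑ i, |b.repr z i - b.repr x i| * a i = v
      rw [hx]
      module
    rw [SetLike.mem_coe, e2]
    refine add_mem (add_mem hy (smul_mem_c hRc (sub_nonneg.2 (le_of_lt hz))))
      (sum_mem fun i _ => ?_)
    generalize b.repr z i - b.repr x i = t
    rcases le_total 0 t with ht | ht
    · rw [abs_of_nonneg ht, mul_smul, ← smul_add]
      exact smul_mem_c (h1 i) ht
    · have e : (|t| * a i) • cls R R + t • b i = (-t) • (a i • cls R R - b i) := by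
        rw [abs_of_nonpos ht]
        module
      rw [e]
      exact smul_mem_c (h2 i) (neg_nonneg.2 ht)
  · refine isOpen_lt ?_ continuous_const
    exact continuous_finsetSum _ fun i _ =>
      (((hcont i).sub continuous_const).abs.mul continuous_const)
  · simpa using hε

end Cone

/-! ### The action of `Hom(-, W)` on the cone -/

section Duality

variable {R : Type u} [CommRing R] [IsDomain R]

/-- The linear endomorphism of `h(R)_ℝ` induced by `Hom(-, W)`. -/
noncomputable def dualMap (R : Type u) [CommRing R] [IsDomain R] (W : Type u) [AddCommGroup W]
    [Module R W] [Module.Finite R W] : HR R →ₗ[ℝ] HR R :=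
  (rkR R).smulRight (cls R W + (Module.finrank R W : ℝ) • cls R R) -
    (Module.finrank R W : ℝ) • LinearMap.id

variable (W : Type u) [AddCommGroup W] [Module R W] [Module.Finite R W]

theorem dualMap_apply (x : HR R) : dualMap R W x =
    rkR R x • (cls R W + (Module.finrank R W : ℝ) • cls R R) - (Module.finrank R W : ℝ) • x := rfl

/-- The numerical form of biduality: `dualMap` is invertible up to scale as soon as `W` has positive
rank. -/
theorem dualMap_dualMap (x : HR R) :
    dualMap R W (dualMap R W x) = ((Module.finrank R W : ℝ) ^ 2) • x := by
  have h1 : rkR R (cls R R) = 1 := by rw [rkR_cls, Module.finrank_self, Nat.cast_one]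
  simp only [dualMap_apply, map_sub, map_smul, map_add, rkR_cls R W, h1]
  module

/-- For `W = R` the map is the reflection in the axis `ℝ[R]`. -/
theorem dualMap_self_apply {t : HR R} (ht : t ∈ kR R) (a : ℝ) :
    dualMap R R (a • cls R R + t) = a • cls R R - t := by
  rw [kR_eq_ker] at ht
  rw [dualMap_apply, map_add, map_smul, LinearMap.mem_ker.1 ht, rkR_cls, Module.finrank_self]
  simp only [Nat.cast_one, smul_eq_mul]
  module

variable [IsNoetherianRing R] [IsIntegrallyClosed R]

theorem dualMap_cls [Module.IsTorsionFree R W] (N : Type u) [AddCommGroup N] [Module R N]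
    [Module.Finite R N] [Module.IsTorsionFree R N] :
    dualMap R W (cls R N) = cls R (N →ₗ[R] W) := by
  rw [dualMap_apply, rkR_cls, Nat.cast_smul_eq_nsmul, Nat.cast_smul_eq_nsmul,
    Nat.cast_smul_eq_nsmul, ← cls_hom, add_sub_cancel_right]

variable [IsLocalRing R]

theorem dualMap_mem_c (hR : IsCohenMacaulay R) (hW : IsMCM R W) (hWi : FiniteInjDim R W)
    {x : HR R} (hx : x ∈ c R) : dualMap R W x ∈ c R := by
  have := hW.isTorsionFree
  induction hx using Submodule.span_induction with
  | mem x hx =>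
    obtain ⟨N, _, _, _, hN, rfl⟩ := hx
    have := hN.isTorsionFree
    rw [dualMap_cls]
    exact cls_mem_c (isMCM_hom hR hW hWi hN)
  | zero => rw [map_zero]; exact zero_mem _
  | add x y _ _ hx hy => rw [map_add]; exact add_mem hx hy
  | smul t x _ hx =>
    have : dualMap R W (t • x) = t • dualMap R W x := (dualMap R W).map_smul t.1 x
    rw [this]
    exact Submodule.smul_mem _ t hx

theorem dualMap_mem_closure (hR : IsCohenMacaulay R) (hW : IsMCM R W) (hWi : FiniteInjDim R W)
    {x : HR R} (hx : x ∈ closure (c R : Set (HR R))) :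
    dualMap R W x ∈ closure (c R : Set (HR R)) :=
  map_mem_closure (IsModuleTopology.continuous_of_linearMap (dualMap R W)) hx
    fun _ hy => dualMap_mem_c W hR hW hWi hy

theorem finrank_pos_of_isTorsionFree (M : Type u) [AddCommGroup M] [Module R M] [Module.Finite R M]
    [Module.IsTorsionFree R M] [Nontrivial M] : 0 < Module.finrank R M := by
  by_contra! h0
  obtain ⟨s, hs, α, β, h1, h2⟩ := exists_maps_comp_eq_smul M (⊥ : Ideal R) (by simp)
  obtain ⟨m, hm⟩ := exists_ne (0 : M)
  have : IsEmpty (Fin (Module.finrank R M)) := by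
    rw [Nat.le_zero.1 h0]
    infer_instance
  have h := h1 m
  rw [Subsingleton.elim (α m) 0, map_zero, eq_comm, smul_eq_zero] at h
  exact h.elim hs hm

/-- `dualMap` sends `[R]` to `[W]`. Applied to `(a + 1)[R] - [W] ∈ c(R)` it gives `(a + 1)[W] - (rk
W)²[R] ∈ c(R)`, so `[W]` is a positive multiple of `[R]` plus an element of the cone. -/
theorem cls_mem_interior_of_finiteInjDim (hR : IsCohenMacaulay R) [Module.Finite ℝ (HR R)]
    [Nontrivial W] (hW : IsMCM R W) (hWi : FiniteInjDim R W) :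
    cls R W ∈ interior (c R : Set (HR R)) := by
  have := hW.isTorsionFree
  have hr : (0 : ℝ) < Module.finrank R W := by exact_mod_cast finrank_pos_of_isTorsionFree W
  obtain ⟨a, ha, -, h⟩ := exists_smul_cls_add_mem_c hR (dualMap R W (cls R R))
  have hD1 : dualMap R W (cls R R) = cls R W := by
    rw [dualMap_apply, rkR_cls, Module.finrank_self]
    module
  -- `a` may be zero, whereas `a + 1` can be inverted.
  have h' : (a + 1) • cls R R - dualMap R W (cls R R) ∈ c R := by
    convert add_mem h (cls_mem_c hR) using 1
    module
  have h2 := dualMap_mem_c W hR hW hWi h'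
  rw [map_sub, map_smul, dualMap_dualMap, hD1] at h2
  have ha1 : 0 < a + 1 := by positivity
  refine mem_interior_c hR (ε := (a + 1)⁻¹ * (Module.finrank R W : ℝ) ^ 2)
    (y := (a + 1)⁻¹ • ((a + 1) • cls R W - ((Module.finrank R W : ℝ) ^ 2) • cls R R))
    (by positivity) (smul_mem_c h2 (by positivity)) ?_
  rw [smul_sub, smul_smul, smul_smul, inv_mul_cancel₀ ha1.ne']
  module

/-- On `k(R)_ℝ` the map `dualMap` is multiplication by `-rk W`, so the part of the closure in
`k(R)_ℝ` is stable under negation. Conversely, rank is nonnegative on the closure, so `x` and `-x`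
both in it forces rank zero. -/
theorem isStronglyConvexCone_closure_iff (hR : IsCohenMacaulay R) [Nontrivial W] (hW : IsMCM R W)
    (hWi : FiniteInjDim R W) :
    IsStronglyConvexCone (closure (c R : Set (HR R))) ↔
      closure (c R : Set (HR R)) ∩ kR R = {0} := by
  have := hW.isTorsionFree
  have hr : (0 : ℝ) < Module.finrank R W := by exact_mod_cast finrank_pos_of_isTorsionFree W
  have : ContinuousSMul ℝ (HR R) := IsModuleTopology.toContinuousSMul ℝ (HR R)
  have hcone : IsConvexCone (closure (c R : Set (HR R))) := by
    intro x hx y hy a b ha hb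
    exact map_mem_closure₂ (f := fun x y : HR R => a • x + b • y) (by fun_prop) hx hy
      fun x hx y hy => add_mem (smul_mem_c hx ha) (smul_mem_c hy hb)
  have hrk : ∀ x ∈ closure (c R : Set (HR R)), 0 ≤ rkR R x := by
    intro x hx
    refine closure_minimal (s := (c R : Set (HR R))) (t := {x | 0 ≤ rkR R x}) ?_
      (isClosed_le continuous_const (IsModuleTopology.continuous_of_linearMap (rkR R))) hx
    intro y hy
    induction hy using Submodule.span_induction with
    | mem x hx =>
      obtain ⟨N, _, _, _, hN, rfl⟩ := hx
      rw [Set.mem_ofPred_eq, rkR_cls]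
      positivity
    | zero => simp
    | add x y _ _ hx hy => simpa using add_nonneg hx hy
    | smul t x _ hx =>
      have : rkR R (t • x) = t * rkR R x := (rkR R).map_smul t.1 x
      rw [Set.mem_ofPred_eq, this]
      exact mul_nonneg t.2 hx
  constructor
  · intro h
    refine Set.Subset.antisymm ?_ ?_
    · rintro x ⟨hx, hxk⟩
      rw [← h.2]
      refine ⟨hx, ?_⟩
      rw [kR_eq_ker] at hxk
      have h1 := dualMap_mem_closure W hR hW hWi hx
      rw [dualMap_apply, LinearMap.mem_ker.1 hxk, zero_smul, zero_sub] at h1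
      have h2 := hcone _ h1 _ h1 (Module.finrank R W : ℝ)⁻¹ 0 (by positivity) le_rfl
      rw [zero_smul, add_zero, smul_neg, smul_smul, inv_mul_cancel₀ hr.ne', one_smul] at h2
      exact h2
    · rintro x rfl
      exact ⟨subset_closure (zero_mem (c R)), zero_mem _⟩
  · intro h
    refine ⟨hcone, Set.Subset.antisymm ?_ ?_⟩
    · rintro x ⟨hx, hx'⟩
      rw [← h]
      refine ⟨hx, ?_⟩
      rw [kR_eq_ker]
      refine LinearMap.mem_ker.2 (le_antisymm ?_ (hrk x hx))
      have := hrk _ hx'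
      rw [map_neg] at this
      linarith
    · rintro x rfl
      refine ⟨subset_closure (zero_mem (c R)), ?_⟩
      rw [Set.mem_ofPred_eq, neg_zero]
      exact subset_closure (zero_mem (c R))

theorem isSymmetricAboutAxis_c (hR : IsCohenMacaulay R) (hG : IsGorenstein R) :
    IsSymmetricAboutAxis R (c R : Set (HR R)) := fun a t ht h => by
  rw [← dualMap_self_apply ht]
  exact dualMap_mem_c R hR hR hG h

theorem isSymmetricAboutAxis_closure_c (hR : IsCohenMacaulay R) (hG : IsGorenstein R) :
    IsSymmetricAboutAxis R (closure (c R : Set (HR R))) := fun a t ht h => by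
  rw [← dualMap_self_apply ht]
  exact dualMap_mem_closure R hR hR hG h

end Duality

/-! ### Minimal free resolutions -/

section MinimalResolution

open IsLocalRing

variable {R : Type u} [CommRing R]

/-- Take the least number of generators: a relation with a unit coefficient would make one of them
superfluous. -/
theorem exists_minimal_cover [IsLocalRing R] (N : Type u) [AddCommGroup N] [Module R N]
    [Module.Finite R N] : ∃ (b : ℕ) (π : (Fin b → R) →ₗ[R] N), Function.Surjective π ∧
      ∀ v ∈ LinearMap.ker π, ∀ i, v i ∈ maximalIdeal R := by
  classical
  have hex := Module.Finite.exists_fin' R N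
  obtain ⟨π, hπ⟩ := Nat.find_spec hex
  refine ⟨Nat.find hex, π, hπ, fun v hv i => ?_⟩
  by_contra hvi
  have hu : IsUnit (v i) := by simpa using hvi
  generalize hn : Nat.find hex = n at *
  obtain _ | n := n
  · exact i.elim0
  refine Nat.find_min hex (m := n) (by omega) ⟨π ∘ₗ (Fintype.linearCombination R
    fun j : Fin n => (Pi.single (i.succAbove j) 1 : Fin (n + 1) → R)), fun x => ?_⟩
  obtain ⟨w, rfl⟩ := hπ x
  obtain ⟨a, ha⟩ := hu.exists_left_inv
  refine ⟨fun j => w (i.succAbove j) - w i * a * v (i.succAbove j), ?_⟩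
  have hv' : π v = 0 := hv
  have : w = (Fintype.linearCombination R
      fun j : Fin n => (Pi.single (i.succAbove j) 1 : Fin (n + 1) → R))
      (fun j => w (i.succAbove j) - w i * a * v (i.succAbove j)) + (w i * a) • v := by
    ext k
    simp only [Fintype.linearCombination_apply, Pi.add_apply, Finset.sum_apply, Pi.smul_apply,
      smul_eq_mul]
    obtain rfl | ⟨k, rfl⟩ := Fin.eq_self_or_eq_succAbove i k
    · rw [Finset.sum_eq_zero, mul_assoc, ha]
      · ring
      · intro j _
        rw [Pi.single_eq_of_ne (Fin.succAbove_ne _ _).symm, mul_zero]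
    · rw [Finset.sum_eq_single k]
      · rw [Pi.single_eq_same]; ring
      · intro j _ hj
        rw [Pi.single_eq_of_ne (by simpa using Ne.symm hj), mul_zero]
      · simp
  conv_rhs => rw [this]
  rw [map_add, map_smul, hv', smul_zero, add_zero, LinearMap.comp_apply]

/-- A minimal free resolution `⋯ → F₁ → F₀ → N → 0`, where `Fᵢ` is free of rank `b i`. -/
structure MinimalFreeResolution (R : Type u) [CommRing R] [IsLocalRing R] (N : Type u)
    [AddCommGroup N] [Module R N] where
  b : ℕ → ℕ
  d : ∀ i : ℕ, (Fin (b (i + 1)) → R) →ₗ[R] (Fin (b i) → R)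
  π : (Fin (b 0) → R) →ₗ[R] N
  surjective : Function.Surjective π
  exact_zero : Function.Exact (d 0) π
  exact_succ : ∀ i, Function.Exact (d (i + 1)) (d i)
  minimal : ∀ i v j, d i v j ∈ maximalIdeal R

theorem nonempty_minimalFreeResolution (R : Type u) [CommRing R] [IsLocalRing R]
    [IsNoetherianRing R] (N : Type u) [AddCommGroup N] [Module R N] [Module.Finite R N] :
    Nonempty (MinimalFreeResolution R N) := by
  obtain ⟨b₀, π, hπ, hmin⟩ := exists_minimal_cover (R := R) N
  have hcov := fun (b : ℕ) (K : Submodule R (Fin b → R)) => exists_minimal_cover (R := R) K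
  choose b' p hp hpmin using hcov
  -- The state is a free rank with a submodule still to be covered; the next submodule is the kernel
  -- of its minimal cover.
  let s : ℕ → (b : ℕ) × Submodule R (Fin b → R) :=
    fun n => Nat.rec ⟨b₀, LinearMap.ker π⟩
      (fun _ t => ⟨b' t.1 t.2, LinearMap.ker (p t.1 t.2)⟩) n
  have hs : ∀ i, ∀ v ∈ (s i).2, ∀ j, v j ∈ maximalIdeal R := by
    rintro (_ | i)
    · exact hmin
    · exact hpmin _ _
  refine ⟨⟨fun n => (s n).1, fun i => (s i).2.subtype ∘ₗ p (s i).1 (s i).2, π, hπ, ?_, ?_, ?_⟩⟩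
  · intro v
    refine ⟨fun hv => ?_, ?_⟩
    · obtain ⟨w, hw⟩ := hp (s 0).1 (s 0).2 ⟨v, hv⟩
      exact ⟨w, congrArg Subtype.val hw⟩
    · rintro ⟨w, rfl⟩
      exact (p (s 0).1 (s 0).2 w).2
  · intro i v
    refine ⟨fun hv => ?_, ?_⟩
    · obtain ⟨w, hw⟩ := hp (s (i + 1)).1 (s (i + 1)).2 ⟨v, Subtype.ext hv⟩
      exact ⟨w, congrArg Subtype.val hw⟩
    · rintro ⟨w, rfl⟩
      exact congrArg Subtype.val (p (s (i + 1)).1 (s (i + 1)).2 w).2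
  · exact fun i v j => hs i _ (p (s i).1 (s i).2 v).2 j

end MinimalResolution

/-! ### Exactness of dual complexes -/

section Dual

variable {R : Type u} [CommRing R] {A B C : Type u} [AddCommGroup A] [AddCommGroup B]
  [AddCommGroup C] [Module R A] [Module R B] [Module R C]

/-- Dualizing an exact sequence `A → B → C` gives an exact sequence if `Ext¹(C / B, R) = 0`. -/
theorem exact_dualMap (f : A →ₗ[R] B) (g : B →ₗ[R] C) (h : Function.Exact f g)
    (hC : ExtVanishes R (C ⧸ LinearMap.range g) R 1) :
    Function.Exact g.dualMap f.dualMap := by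
  intro φ
  refine ⟨fun hφ => ?_, ?_⟩
  · have hker : LinearMap.ker g ≤ LinearMap.ker φ := by
      intro x hx
      obtain ⟨y, rfl⟩ := (h x).1 hx
      exact LinearMap.congr_fun hφ y
    -- `φ` descends to the image of `g` and then extends to `C`.
    obtain ⟨ψ, hψ⟩ := exists_comp_eq_of_extVanishes (LinearMap.range g).subtype
      (LinearMap.range g).mkQ (Submodule.subtype_injective _)
      (LinearMap.exact_subtype_mkQ _) (Submodule.mkQ_surjective _) R hC
      ((LinearMap.ker g).liftQ φ hker ∘ₗ g.quotKerEquivRange.symm.toLinearMap)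
    refine ⟨ψ, LinearMap.ext fun x => ?_⟩
    have := LinearMap.congr_fun hψ (g.quotKerEquivRange (Submodule.Quotient.mk x))
    simpa using this
  · rintro ⟨ψ, rfl⟩
    ext x
    simp [h.apply_apply_eq_zero x]

open IsLocalRing

variable [IsLocalRing R] {N : Type u} [AddCommGroup N] [Module R N]

/-- These cokernels are `N` and its successive syzygies, and the vanishing passes along by dimension
shifting. -/
theorem MinimalFreeResolution.extVanishes_quotient (F : MinimalFreeResolution R N)
    (hN : ∀ i, 0 < i → ExtVanishes R N R i) (i j : ℕ) (hj : 0 < j) :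
    ExtVanishes R ((Fin (F.b i) → R) ⧸ LinearMap.range (F.d i)) R j := by
  induction i generalizing j with
  | zero =>
    let e := F.exact_zero.linearEquivOfSurjective F.surjective
    exact extVanishes_congr_left _ e (hN j hj)
  | succ i ih =>
    have hk : LinearMap.ker (F.d i) = LinearMap.range (F.d (i + 1)) :=
      (F.exact_succ i).linearMap_ker_eq
    refine extVanishes_congr_left R ((Submodule.quotEquivOfEq _ (LinearMap.ker (F.d i))
      hk.symm).trans (F.d i).quotKerEquivRange) ?_
    refine extVanishes_contravariant_left (LinearMap.range (F.d i)).subtype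
      (LinearMap.range (F.d i)).mkQ (Submodule.subtype_injective _)
      (LinearMap.exact_subtype_mkQ _) (Submodule.mkQ_surjective _) R j ?_ (ih _ (by omega))
    obtain ⟨j, rfl⟩ := Nat.exists_eq_succ_of_ne_zero hj.ne'
    exact extVanishes_of_free _ _ _

theorem MinimalFreeResolution.exact_dualMap_zero (F : MinimalFreeResolution R N) :
    Function.Exact F.π.dualMap (F.d 0).dualMap := by
  refine exact_dualMap _ _ F.exact_zero ?_
  rw [LinearMap.range_eq_top.2 F.surjective]
  exact extVanishes_of_subsingleton_left _ _

theorem MinimalFreeResolution.exact_dualMap_succ (F : MinimalFreeResolution R N)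
    (hN : ∀ i, 0 < i → ExtVanishes R N R i) (i : ℕ) :
    Function.Exact (F.d i).dualMap (F.d (i + 1)).dualMap :=
  exact_dualMap _ _ (F.exact_succ i) (F.extVanishes_quotient hN i 1 one_pos)

end Dual

/-! ### Transposes as duals of maps between standard free modules -/

section Transpose

variable {R : Type u} [CommRing R] {l m n : ℕ}

/-- The transpose of a linear map between standard free modules. -/
noncomputable def tr (δ : (Fin m → R) →ₗ[R] (Fin n → R)) : (Fin n → R) →ₗ[R] (Fin m → R) :=
  (dotProductEquiv R (Fin m)).symm.toLinearMap ∘ₗ δ.dualMap ∘ₗ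
    (dotProductEquiv R (Fin n)).toLinearMap

theorem dotProductEquiv_comp_tr (δ : (Fin m → R) →ₗ[R] (Fin n → R)) :
    (dotProductEquiv R (Fin m)).toLinearMap ∘ₗ tr δ =
      δ.dualMap ∘ₗ (dotProductEquiv R (Fin n)).toLinearMap := by
  ext; simp [tr]

theorem tr_dotProduct (δ : (Fin m → R) →ₗ[R] (Fin n → R)) (w : Fin n → R) (v : Fin m → R) :
    tr δ w ⬝ᵥ v = w ⬝ᵥ δ v :=
  LinearMap.congr_fun (LinearMap.congr_fun (dotProductEquiv_comp_tr δ) w) v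

theorem dualMap_tr_comp_dotProductEquiv (δ : (Fin m → R) →ₗ[R] (Fin n → R)) :
    (tr δ).dualMap ∘ₗ (dotProductEquiv R (Fin m)).toLinearMap =
      (dotProductEquiv R (Fin n)).toLinearMap ∘ₗ δ := by
  refine LinearMap.ext fun v => LinearMap.ext fun w => ?_
  change v ⬝ᵥ tr δ w = δ v ⬝ᵥ w
  rw [dotProduct_comm, tr_dotProduct, dotProduct_comm]

theorem exact_tr_iff (f : (Fin l → R) →ₗ[R] (Fin m → R)) (g : (Fin m → R) →ₗ[R] (Fin n → R)) :
    Function.Exact (tr g) (tr f) ↔ Function.Exact g.dualMap f.dualMap :=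
  (Function.Exact.iff_of_ladder_linearEquiv (dotProductEquiv_comp_tr g).symm
    (dotProductEquiv_comp_tr f).symm).symm

theorem exact_dualMap_tr_iff (f : (Fin l → R) →ₗ[R] (Fin m → R))
    (g : (Fin m → R) →ₗ[R] (Fin n → R)) :
    Function.Exact (tr f).dualMap (tr g).dualMap ↔ Function.Exact f g :=
  Function.Exact.iff_of_ladder_linearEquiv (f₁₂ := f) (f₂₃ := g)
    (g₁₂ := (tr f).dualMap) (g₂₃ := (tr g).dualMap) (dualMap_tr_comp_dotProductEquiv f)
    (dualMap_tr_comp_dotProductEquiv g)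

theorem tr_apply_mem {I : Ideal R} (δ : (Fin m → R) →ₗ[R] (Fin n → R))
    (h : ∀ v j, δ v j ∈ I) (w : Fin n → R) (i : Fin m) : tr δ w i ∈ I := by
  have := tr_dotProduct δ w (Pi.single i 1)
  rw [dotProduct_single, mul_one] at this
  rw [this]
  exact sum_mem fun j _ => I.mul_mem_left _ (h _ _)

end Transpose

/-! ### Gluing resolutions of `M` and `M*` into a complete resolution -/

section Gluing

open IsLocalRing

variable {R : Type u} [CommRing R] [IsLocalRing R] {M : Type u} [AddCommGroup M] [Module R M]
  (F : MinimalFreeResolution R M) (G : MinimalFreeResolution R (Module.Dual R M))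

/-- The embedding of `M` into a free module defined by generators of `M*`. -/
noncomputable def glueEmbedding : M →ₗ[R] (Fin (G.b 0) → R) :=
  (dotProductEquiv R (Fin (G.b 0))).symm.toLinearMap ∘ₗ G.π.dualMap ∘ₗ Module.Dual.eval R M

theorem dotProduct_glueEmbedding (g : Fin (G.b 0) → R) (x : M) :
    g ⬝ᵥ glueEmbedding G x = G.π g x := by
  rw [dotProduct_comm, ← dotProductEquiv_apply_apply]
  simp [glueEmbedding]

/-- The connecting map of a complete resolution. -/
noncomputable def glue : (Fin (F.b 0) → R) →ₗ[R] (Fin (G.b 0) → R) :=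
  glueEmbedding G ∘ₗ F.π

theorem glueEmbedding_injective [Module.IsReflexive R M] :
    Function.Injective (glueEmbedding G) := by
  exact (dotProductEquiv R (Fin (G.b 0))).symm.injective.comp
    ((LinearMap.dualMap_injective_of_surjective G.surjective).comp
      (Module.bijective_dual_eval R M).1)

theorem exact_glue [Module.IsReflexive R M] : Function.Exact (F.d 0) (glue F G) :=
  F.exact_zero.comp_injective _ (glueEmbedding_injective G) (map_zero _)

theorem exact_glue_tr [Module.IsReflexive R M] : Function.Exact (glue F G) (tr (G.d 0)) := by
  have h : Function.Surjective (Module.Dual.eval R M ∘ₗ F.π) :=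
    (Module.bijective_dual_eval R M).2.comp F.surjective
  have h2 : Function.Exact (G.π.dualMap ∘ₗ (Module.Dual.eval R M ∘ₗ F.π)) (G.d 0).dualMap :=
    (Function.Surjective.comp_exact_iff_exact h).2 G.exact_dualMap_zero
  refine (Function.Exact.iff_of_ladder_linearEquiv (e₁ := LinearEquiv.refl _ _) ?_
    (dotProductEquiv_comp_tr (G.d 0)).symm).1 h2
  ext
  simp [glue, glueEmbedding]

/-- The dual of the connecting map factors through `M*`, so its exactness follows from the
resolution `G` of `M*` and the dual of `F`. -/
theorem dualMap_glue_comp : (glue F G).dualMap ∘ₗ (dotProductEquiv R (Fin (G.b 0))).toLinearMap =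
    F.π.dualMap ∘ₗ G.π :=
  LinearMap.ext fun g => LinearMap.ext fun x => dotProduct_glueEmbedding G g (F.π x)

theorem exact_dualMap_glue : Function.Exact (glue F G).dualMap (F.d 0).dualMap := by
  have h : Function.Exact (F.π.dualMap ∘ₗ G.π) (F.d 0).dualMap :=
    (Function.Surjective.comp_exact_iff_exact G.surjective).2 F.exact_dualMap_zero
  rw [← dualMap_glue_comp] at h
  exact (Function.Surjective.comp_exact_iff_exact (LinearEquiv.surjective _)).1 h

theorem exact_dualMap_tr_glue : Function.Exact (tr (G.d 0)).dualMap (glue F G).dualMap := by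
  have h : Function.Exact (G.d 0) (F.π.dualMap ∘ₗ G.π) :=
    G.exact_zero.comp_injective _ (LinearMap.dualMap_injective_of_surjective F.surjective)
      (map_zero _)
  refine (Function.Exact.iff_of_ladder_linearEquiv (e₃ := LinearEquiv.refl _ _)
    (dualMap_tr_comp_dotProductEquiv (G.d 0)) ?_).2 h
  rw [dualMap_glue_comp]
  rfl

/-- The entries are values on `M` of generators of `M*`; a unit among them would give a surjection
`M → R`. -/
theorem glue_apply_mem (hM : ¬ ∃ f : M →ₗ[R] R, Function.Surjective f) (x : Fin (F.b 0) → R)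
    (i : Fin (G.b 0)) : glue F G x i ∈ maximalIdeal R := by
  by_contra hx
  have hu : IsUnit (glue F G x i) := by simpa using hx
  refine hM ⟨G.π (Pi.single i 1), fun r => ?_⟩
  obtain ⟨a, ha⟩ := hu.exists_left_inv
  refine ⟨(r * a) • F.π x, ?_⟩
  rw [map_smul, ← dotProduct_glueEmbedding, single_dotProduct, one_mul, smul_eq_mul, mul_assoc]
  change r * (a * glue F G x i) = r
  rw [ha, mul_one]

theorem nonempty_minimalCompleteResolution [IsNoetherianRing R] [Module.Finite R M]
    (h : IsTotallyReflexive R M) (hM : ¬ ∃ f : M →ₗ[R] R, Function.Surjective f) :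
    Nonempty (MinimalCompleteResolution R M) := by
  have := h.isReflexive
  obtain ⟨F⟩ := nonempty_minimalFreeResolution R M
  have hdual : Module.Finite R (Module.Dual R M) := inferInstance
  obtain ⟨G⟩ := nonempty_minimalFreeResolution R (Module.Dual R M)
  -- Degrees `≥ 0` carry the resolution of `M`, and degree `-(n + 1)` carries the dual of `Gₙ`. The
  -- connecting map is `d (-1)`, and `d (-(n + 2))` is the transpose of `G.d n`.
  let b : ℤ → ℕ
    | .ofNat n => F.b n
    | .negSucc n => G.b n
  let d : ∀ i : ℤ, (Fin (b (i + 1)) → R) →ₗ[R] (Fin (b i) → R)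
    | .ofNat n => F.d n
    | .negSucc 0 => glue F G
    | .negSucc (n + 1) => tr (G.d n)
  have hmem : ∀ {n : ℕ} {v : Fin n → R}, (∀ j, v j ∈ maximalIdeal R) →
      v ∈ maximalIdeal R • (⊤ : Submodule R (Fin n → R)) :=
    fun {n v} hv => map_mem_smul_top_of_forall_mem _ LinearMap.id v hv
  refine ⟨⟨b, d, ?_, ?_, ?_, ?_⟩⟩
  · rintro (n | _ | _ | n)
    · exact F.exact_succ n
    · exact exact_glue F G
    · exact exact_glue_tr F G
    · exact (exact_tr_iff _ _).2 (G.exact_dualMap_succ h.ext_dual_eq_zero n)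
  · rintro (n | _ | _ | n)
    · exact F.exact_dualMap_succ h.ext_eq_zero n
    · exact exact_dualMap_glue F G
    · exact exact_dualMap_tr_glue F G
    · exact (exact_dualMap_tr_iff _ _).2 (G.exact_succ n)
  · rintro (n | _ | n) _ ⟨v, rfl⟩
    · exact hmem (F.minimal n v)
    · exact hmem (glue_apply_mem F G hM v)
    · exact hmem (tr_apply_mem (G.d n) (G.minimal n) v)
  · exact (LinearEquiv.ofInjective _ (glueEmbedding_injective G)).trans
      (LinearEquiv.ofEq _ (LinearMap.range (glue F G))
        (LinearMap.range_comp_of_range_eq_top _ (LinearMap.range_eq_top.2 F.surjective)).symm)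

end Gluing

/-! ### Maximal Cohen-Macaulay modules are reflexive -/

section Reflexive

open scoped Pointwise
open IsLocalRing RingTheory.Sequence

variable {R : Type u} [CommRing R] [IsNoetherianRing R] [IsDomain R] [IsIntegrallyClosed R]
  {M : Type u} [AddCommGroup M] [Module R M] [Module.Finite R M]

theorem eval_injective_of_isTorsionFree [Module.IsTorsionFree R M] :
    Function.Injective (Module.Dual.eval R M) := by
  obtain ⟨s, hs, α, β, h1, h2⟩ := exists_maps_comp_eq_smul M (⊥ : Ideal R) (by simp)
  rw [injective_iff_map_eq_zero]
  intro m hm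
  have hα : α m = 0 := by
    ext i
    exact LinearMap.congr_fun hm (LinearMap.proj i ∘ₗ α)
  have h := h1 m
  rw [hα, map_zero, eq_comm, smul_eq_zero] at h
  exact h.resolve_left hs

/-- At height at most one `M` is free up to `s`, with `β` of the unit vectors and the coordinates of
`α` playing the role of dual bases; the witness is the usual biduality formula in them. -/
theorem exists_eval_eq_smul [Module.IsTorsionFree R M] (c : Module.Dual R (Module.Dual R M))
    (p : Ideal R) [p.IsPrime] (hp : p.height ≤ 1) :
    ∃ s ∉ p, ∃ m, Module.Dual.eval R M m = s • c := by
  obtain ⟨s, hs, α, β, h1, -⟩ := exists_maps_comp_eq_smul M p hp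
  refine ⟨s, hs, β fun i => c (LinearMap.proj i ∘ₗ α), LinearMap.ext fun g => ?_⟩
  have hg : s • g = ∑ i, g (β (Pi.single i 1)) • (LinearMap.proj i ∘ₗ α) := by
    ext m
    rw [LinearMap.smul_apply, ← map_smul, ← h1, LinearMap.pi_apply_eq_sum_univ β, map_sum,
      LinearMap.sum_apply]
    refine Finset.sum_congr rfl fun i _ => ?_
    rw [map_smul, smul_eq_mul, mul_comm]
    simp only [LinearMap.smul_apply, smul_eq_mul, LinearMap.comp_apply, LinearMap.proj_apply]
    congr 3
    ext j
    simp [Pi.single_apply, eq_comm]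
  rw [LinearMap.smul_apply, ← map_smul, hg, map_sum, Module.Dual.eval_apply,
    LinearMap.pi_apply_eq_sum_univ β, map_sum]
  refine Finset.sum_congr rfl fun i _ => ?_
  rw [map_smul, map_smul, smul_eq_mul, smul_eq_mul, mul_comm]
  congr 3
  ext j
  simp [Pi.single_apply, eq_comm]

/-- A maximal Cohen-Macaulay module over a normal domain is reflexive. -/
theorem IsMCM.isReflexive (hM : IsMCM R M) : Module.IsReflexive R M := by
  have := hM.isTorsionFree
  have hinj : Function.Injective (Module.Dual.eval R M) := eval_injective_of_isTorsionFree
  refine ⟨hinj, ?_⟩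
  rw [← LinearMap.range_eq_top, ← Submodule.Quotient.subsingleton_iff]
  by_contra hC
  rw [not_subsingleton_iff_nontrivial] at hC
  obtain ⟨P, hP⟩ := associatedPrimes.nonempty R
    (Module.Dual R (Module.Dual R M) ⧸ LinearMap.range (Module.Dual.eval R M))
  have hPs := AssociatedPrimes.mem_iff.1 hP
  rw [isAssociatedPrime_iff] at hPs
  obtain ⟨hPp, c', hc'⟩ := hPs
  obtain ⟨c, rfl⟩ := Submodule.Quotient.mk_surjective _ c'
  have hPc : ∀ s, s ∈ P ↔ ∃ m, Module.Dual.eval R M m = s • c := fun s => by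
    rw [hc', Submodule.mem_colon_singleton, Submodule.mem_bot, ← Submodule.Quotient.mk_smul,
      Submodule.Quotient.mk_eq_zero, LinearMap.mem_range]
  have hht : ((2 : ℕ) : ℕ∞) ≤ P.height := by
    by_contra! hlt
    obtain ⟨s, hs, m, hm⟩ := exists_eval_eq_smul c P (Order.le_of_lt_add_one (by
      rw [one_add_one_eq_two]; exact hlt))
    exact hs ((hPc s).2 ⟨m, hm⟩)
  obtain ⟨rs, hrs, hwr, hl⟩ := exists_isWeaklyRegular_of_le_depth two_pos
    (hht.trans (hM ⟨P, hPp⟩))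
  match rs, hrs, hwr, hl with
  | y :: z :: rs, hrs, hwr, _ =>
    have hy := hrs y List.mem_cons_self
    have hz := hrs z (List.mem_cons_of_mem _ List.mem_cons_self)
    obtain ⟨hyreg, hwr⟩ := (isWeaklyRegular_cons_iff _ _ _).1 hwr
    have hzreg := ((isWeaklyRegular_cons_iff _ _ _).1 hwr).1
    obtain ⟨⟨y₀, s⟩, rfl⟩ := IsLocalization.mk'_surjective P.primeCompl y
    obtain ⟨⟨z₀, t⟩, rfl⟩ := IsLocalization.mk'_surjective P.primeCompl z
    have hy₀ : y₀ ∈ P := (IsLocalization.AtPrime.mk'_mem_maximal_iff _ P y₀ s).1 hy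
    have hz₀ : z₀ ∈ P := (IsLocalization.AtPrime.mk'_mem_maximal_iff _ P z₀ t).1 hz
    change IsSMulRegular _ (IsLocalization.mk' _ y₀ s) at hyreg
    change IsSMulRegular (QuotSMulTop (IsLocalization.mk' _ y₀ s) _)
      (IsLocalization.mk' _ z₀ t) at hzreg
    rw [← Localization.mk_eq_mk'] at hyreg hzreg
    obtain ⟨m₁, hm₁⟩ := (hPc y₀).1 hy₀
    obtain ⟨m₂, hm₂⟩ := (hPc z₀).1 hz₀
    -- Here `m₁` and `m₂` represent `y₀ • c` and `z₀ • c`. As `z` is regular modulo `y`, this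
    -- relation makes `m₁` divisible by `y₀` up to some `a ∉ P`; cancelling `y₀` puts `a • c` in the
    -- image of `M`, against `a ∉ P`.
    have hm : z₀ • m₁ = y₀ • m₂ := hinj (by rw [map_smul, map_smul, hm₁, hm₂, smul_comm])
    have key : ∃ a ∉ P, ∃ n, a • m₁ = y₀ • n := by
      have h1 : Localization.mk z₀ t • LocalizedModule.mk m₁ (1 : P.primeCompl) =
          Localization.mk y₀ s • LocalizedModule.mk ((s : R) • m₂) t := by
        rw [LocalizedModule.mk_smul_mk, LocalizedModule.mk_smul_mk, mul_one, hm, smul_comm y₀]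
        exact (LocalizedModule.mk_cancel_common_left s t (y₀ • m₂)).symm
      have h2 : LocalizedModule.mk m₁ (1 : P.primeCompl) ∈ Localization.mk y₀ s •
          (⊤ : Submodule (Localization.AtPrime P) (LocalizedModule P.primeCompl M)) := by
        rw [← Submodule.Quotient.mk_eq_zero]
        refine hzreg ?_
        change Localization.mk z₀ t • Submodule.Quotient.mk _ = Localization.mk z₀ t • (0 : _ ⧸ _)
        rw [← Submodule.Quotient.mk_smul, smul_zero, Submodule.Quotient.mk_eq_zero, h1]
        exact Submodule.smul_mem_pointwise_smul _ _ _ trivial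
      obtain ⟨w, -, hw⟩ := (Submodule.mem_smul_pointwise_iff_exists _ _ _).1 h2
      obtain ⟨n, u, rfl⟩ : ∃ n u, LocalizedModule.mk n u = w := by
        induction w with
        | h n u => exact ⟨n, u, rfl⟩
      rw [LocalizedModule.mk_smul_mk, LocalizedModule.mk_eq] at hw
      obtain ⟨v, hv⟩ := hw
      refine ⟨(v * (s * u) : P.primeCompl), (v * (s * u)).2, (v : R) • n, ?_⟩
      rw [one_smul] at hv
      rw [Submonoid.coe_mul, mul_smul, smul_comm y₀]
      exact hv.symm
    obtain ⟨a, ha, n, hn⟩ := key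
    -- If `y₀ = 0` is regular on the localization, then `M = 0`.
    rcases eq_or_ne y₀ 0 with rfl | hy0
    · have hM0 : ∀ m : M, m = 0 := by
        intro m
        have h : LocalizedModule.mkLinearMap P.primeCompl M m = 0 := hyreg (by
          rw [Localization.mk_zero]
          simp)
        obtain ⟨u, hu⟩ := (IsLocalizedModule.eq_zero_iff P.primeCompl
          (LocalizedModule.mkLinearMap P.primeCompl M)).1 h
        exact (smul_eq_zero.1 hu).resolve_left fun h => u.2 (h ▸ P.zero_mem)
      have : Subsingleton M := ⟨fun x y => by rw [hM0 x, hM0 y]⟩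
      exact ha ((hPc a).2 ⟨0, Subsingleton.elim _ _⟩)
    · refine ha ((hPc a).2 ⟨n, ?_⟩)
      have h : y₀ • (Module.Dual.eval R M n - a • c) = 0 := by
        rw [smul_sub, ← map_smul, ← hn, map_smul, hm₁, smul_comm, sub_self]
      exact sub_eq_zero.1 ((smul_eq_zero.1 h).resolve_left hy0)

end Reflexive

/-! ### Ranks of syzygies of modules on the boundary -/

section Boundary

variable {R : Type u} [CommRing R] {M : Type u} [AddCommGroup M] [Module R M]

variable (R) in
/-- The component of `[N]` in `k(R)_ℝ`. -/
noncomputable def clsTors (N : Type u) [AddCommGroup N] [Module R N] [Module.Finite R N] : HR R :=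
  cls R N - (Module.finrank R N : ℝ) • cls R R

theorem cls_eq_add_clsTors [Module.Finite R M] :
    cls R M = (Module.finrank R M : ℝ) • cls R R + clsTors R M := by
  rw [clsTors]
  module

theorem IsTotallyReflexive.isMCM_dual [IsNoetherianRing R] [Module.Finite R M]
    (hR : IsCohenMacaulay R) (hM : IsTotallyReflexive R M) : IsMCM R (Module.Dual R M) :=
  isMCM_hom_of_extVanishes hR hM.ext_eq_zero

theorem IsTotallyReflexive.isMCM [IsNoetherianRing R] [Module.Finite R M]
    (hR : IsCohenMacaulay R) (hM : IsTotallyReflexive R M) : IsMCM R M := by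
  have := hM.isReflexive
  exact isMCM_congr (Module.evalEquiv R M).symm (isMCM_hom_of_extVanishes hR hM.ext_dual_eq_zero)

variable [IsLocalRing R] (F : MinimalCompleteResolution R M) (i : ℤ)

theorem exact_subtype_rangeRestrict :
    Function.Exact (LinearMap.range (F.d (i + 1))).subtype (F.d i).rangeRestrict := by
  rw [← (F.exact i).linearMap_ker_eq, ← LinearMap.ker_rangeRestrict]
  exact exact_subtype_ker _

theorem cls_range_add_cls_range :
    cls R (LinearMap.range (F.d (i + 1))) + cls R (LinearMap.range (F.d i)) =
      (F.b (i + 1) : ℝ) • cls R R := by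
  rw [← cls_of_exact _ (F.d i).rangeRestrict (Submodule.injective_subtype _)
    (exact_subtype_rangeRestrict F i) (LinearMap.surjective_rangeRestrict _), cls_fin_fun,
    Nat.cast_smul_eq_nsmul]

/-- Consecutive classes add up to a multiple of `[R]`. -/
theorem clsTors_range_succ [IsDomain R] :
    clsTors R (LinearMap.range (F.d (i + 1))) = - clsTors R (LinearMap.range (F.d i)) := by
  have h := cls_range_add_cls_range F i
  have hr := congrArg (rkR R) h
  rw [map_add, map_smul, rkR_cls, rkR_cls, rkR_cls, Module.finrank_self, Nat.cast_one,
    smul_eq_mul, mul_one] at hr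
  rw [← hr] at h
  rw [clsTors, clsTors, eq_sub_of_add_eq h]
  module

theorem clsTors_range_eq_or [IsDomain R] [Module.Finite R M] :
    clsTors R (LinearMap.range (F.d i)) = clsTors R M ∨
      clsTors R (LinearMap.range (F.d i)) = - clsTors R M := by
  have h0 : clsTors R (LinearMap.range (F.d (-1))) = clsTors R M := by
    rw [clsTors, clsTors, ← cls_congr F.iso, F.iso.finrank_eq]
  induction i using Int.inductionOn' (b := -1) with
  | zero => exact Or.inl h0
  | succ k _ ih =>
    rw [clsTors_range_succ]
    rcases ih with h | h <;> simp [h]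
  | pred k _ ih =>
    obtain ⟨k, rfl⟩ : ∃ j, k = j + 1 := ⟨k - 1, by ring⟩
    rw [add_sub_cancel_right]
    rw [clsTors_range_succ] at ih
    rcases ih with h | h
    · exact Or.inr (neg_eq_iff_eq_neg.1 h)
    · exact Or.inl (neg_inj.1 h)

variable [IsNoetherianRing R]

/-- Each image is a syzygy of the next one to the right, without end, so induction on the degree of
Serre's condition runs over all `i` at once. -/
theorem isMCM_range (hR : IsCohenMacaulay R) : IsMCM R (LinearMap.range (F.d i)) := by
  rw [isMCM_iff_forall_serreCondition]
  intro n
  induction n generalizing i with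
  | zero => exact serreCondition_zero
  | succ n ih =>
    obtain ⟨i, rfl⟩ : ∃ k, i = k + 1 := ⟨i - 1, by ring⟩
    exact serreCondition_succ_of_exact _ (F.d i).rangeRestrict (Submodule.injective_subtype _)
      (exact_subtype_rangeRestrict F i) (LinearMap.surjective_rangeRestrict _) n
      (isMCM_fun hR _) (ih i)

theorem isMCM_dual_range (hR : IsCohenMacaulay R) :
    IsMCM R (Module.Dual R (LinearMap.range (F.d i))) := by
  rw [isMCM_iff_forall_serreCondition]
  intro n
  induction n generalizing i with
  | zero => exact serreCondition_zero
  | succ n ih =>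
    refine serreCondition_succ_of_exact (LinearMap.lcomp R R (F.d i).rangeRestrict)
      (LinearMap.lcomp R R (LinearMap.range (F.d (i + 1))).subtype)
      (LinearMap.lcomp_injective_of_surjective _ (LinearMap.surjective_rangeRestrict _))
      (LinearMap.exact_lcomp_of_exact_of_surjective _ (exact_subtype_rangeRestrict F i)
        (LinearMap.surjective_rangeRestrict _)) ?_ n
      (isMCM_congr (dotProductEquiv R (Fin (F.b (i + 1)))) (isMCM_fun hR _)) (ih (i + 1))
    intro φ
    -- A functional on the image of `d (i + 1)`, pulled back to its source, is killed by the dual of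
    -- the next differential, so exactness of the dual complex extends it to the target.
    obtain ⟨ψ, hψ⟩ := (F.dual_exact (i + 1) (φ ∘ₗ (F.d (i + 1)).rangeRestrict)).1 (by
      ext x
      have h : (F.d (i + 1)).rangeRestrict (F.d (i + 1 + 1) (Pi.single x 1)) = 0 :=
        Subtype.ext ((F.exact (i + 1)).apply_apply_eq_zero _)
      simp [h])
    refine ⟨ψ, LinearMap.ext ?_⟩
    rintro ⟨_, x, rfl⟩
    exact LinearMap.congr_fun hψ x

variable [Module.Finite R M]

theorem cls_mem_interior_of_surjective (hR : IsCohenMacaulay R) [Module.Finite ℝ (HR R)]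
    (hM : IsMCM R M) (f : M →ₗ[R] R) (hf : Function.Surjective f) :
    cls R M ∈ interior (c R : Set (HR R)) := by
  have hK : IsMCM R (LinearMap.ker f) := isMCM_of_exact_left _ f
    (LinearMap.ker f).injective_subtype (exact_subtype_ker f) hf hM hR
  refine mem_interior_c hR one_pos (cls_mem_c hK) ?_
  rw [cls_of_exact _ f (LinearMap.ker f).injective_subtype (exact_subtype_ker f) hf, one_smul,
    add_comm]

variable [IsDomain R]

variable [IsIntegrallyClosed R]

theorem clsTors_dual [Module.IsTorsionFree R M] : cls R (Module.Dual R M) =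
    (Module.finrank R M : ℝ) • cls R R - clsTors R M := by
  rw [clsTors, ← dualMap_cls R M, dualMap_apply, rkR_cls, Module.finrank_self]
  module

theorem IsMCM.isTotallyReflexive (hR : IsCohenMacaulay R) (hG : IsGorenstein R)
    (hM : IsMCM R M) : IsTotallyReflexive R M where
  isReflexive := hM.isReflexive
  ext_eq_zero := extVanishes_of_isMCM hR hG M hM
  ext_dual_eq_zero := extVanishes_of_isMCM hR hG _ (isMCM_hom hR hR hG hM)

/-- Let `Z` be the image and `t` the `k`-component of `[M]`. Then `[Z]` and `[Z*]` are `rk Z [R] +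
t` and `rk Z [R] - t` in some order. Adding `(rk M - rk Z)[R]` to them gives `[M]` and `[M*]`. -/
theorem cls_mem_interior_of_finrank_range_lt (hR : IsCohenMacaulay R) [Module.Finite ℝ (HR R)]
    [Module.IsTorsionFree R M]
    (h : Module.finrank R (LinearMap.range (F.d i)) < Module.finrank R M) :
    cls R M ∈ interior (c R : Set (HR R)) ∧
      cls R (Module.Dual R M) ∈ interior (c R : Set (HR R)) := by
  have hZ := isMCM_range F i hR
  have := hZ.isTorsionFree
  have h1 := cls_mem_c hZ
  have h2 := cls_mem_c (isMCM_dual_range F i hR)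
  rw [cls_eq_add_clsTors] at h1
  rw [clsTors_dual] at h2
  have h3 : ∀ x : HR R, (Module.finrank R M : ℝ) • cls R R + x =
      ((Module.finrank R M : ℝ) - Module.finrank R (LinearMap.range (F.d i))) • cls R R +
        ((Module.finrank R (LinearMap.range (F.d i)) : ℝ) • cls R R + x) := fun x => by module
  have hpos : 0 < (Module.finrank R M : ℝ) - Module.finrank R (LinearMap.range (F.d i)) :=
    sub_pos.2 (by exact_mod_cast h)
  rw [clsTors_dual, cls_eq_add_clsTors (M := M), sub_eq_add_neg]
  rw [sub_eq_add_neg] at h2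
  rcases clsTors_range_eq_or F i with e | e
  · rw [e] at h1 h2
    exact ⟨mem_interior_c hR hpos h1 (h3 _), mem_interior_c hR hpos h2 (h3 _)⟩
  · rw [e] at h1
    rw [e, neg_neg] at h2
    exact ⟨mem_interior_c hR hpos h2 (h3 _), mem_interior_c hR hpos h1 (h3 _)⟩

theorem IsTotallyReflexive.syzygyRanksGE (hR : IsCohenMacaulay R) [Module.Finite ℝ (HR R)]
    (hM : IsTotallyReflexive R M)
    (h : cls R M ∈ frontier (c R : Set (HR R)) ∨
      cls R (Module.Dual R M) ∈ frontier (c R : Set (HR R))) : SyzygyRanksGE R M := by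
  have := (hM.isMCM hR).isTorsionFree
  have hint : ¬ (cls R M ∈ interior (c R : Set (HR R)) ∧
      cls R (Module.Dual R M) ∈ interior (c R : Set (HR R))) := fun hi =>
    h.elim (fun h => h.2 hi.1) (fun h => h.2 hi.2)
  refine ⟨nonempty_minimalCompleteResolution hM ?_, fun F i => ?_⟩
  · rintro ⟨f, hf⟩
    obtain ⟨x, hx⟩ := hf 1
    -- A surjection `f` with `f x = 1` also makes evaluation at `x` a surjection `M* → R`, so both
    -- classes would be interior.
    refine hint ⟨cls_mem_interior_of_surjective hR (hM.isMCM hR) f hf,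
      cls_mem_interior_of_surjective hR (hM.isMCM_dual hR) (Module.Dual.eval R M x)
        fun r => ⟨r • f, ?_⟩⟩
    simp [hx]
  · by_contra! hlt
    exact hint (cls_mem_interior_of_finrank_range_lt F (i - 1) hR hlt)

end Boundary

/-! ### The canonical module is nonzero -/

section Canonical

open IsLocalRing

variable {R : Type u} [CommRing R] [IsLocalRing R]

theorem IsCanonicalModule.nontrivial {ω : Type u} [AddCommGroup ω] [Module R ω]
    (hω : IsCanonicalModule R ω) : Nontrivial ω := by
  by_contra hn
  have := not_nontrivial_iff_subsingleton.1 hn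
  obtain ⟨d, -, ⟨e⟩⟩ := hω.type_one
  have h : ExtVanishes R (ResidueField R) ω d := extVanishes_of_subsingleton _ d
  exact not_subsingleton (ResidueField R) e.symm.injective.subsingleton

end Canonical

end CMCone

theorem theorem1p1 (R : Type u) [CommRing R] [IsNoetherianRing R] [IsLocalRing R]
    [IsDomain R] [IsIntegrallyClosed R] (hR : CMCone.IsCohenMacaulay R)
    (ω : Type u) [AddCommGroup ω] [Module R ω] [Module.Finite R ω]
    (hω : CMCone.IsCanonicalModule R ω)
    (hfin : Module.Finite ℝ (CMCone.HR R)) :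
    -- interior points
    (CMCone.cls R R ∈ interior (CMCone.c R : Set (CMCone.HR R)) ∧
      CMCone.cls R ω ∈ interior (CMCone.c R : Set (CMCone.HR R))) ∧
    -- strong convexity of the closure
    (CMCone.IsStronglyConvexCone (closure (CMCone.c R : Set (CMCone.HR R))) ↔
      closure (CMCone.c R : Set (CMCone.HR R)) ∩ CMCone.kR R = {0}) ∧
    -- the Gorenstein case
    (CMCone.IsGorenstein R →
      (CMCone.IsSymmetricAboutAxis R (CMCone.c R : Set (CMCone.HR R)) ∧
        CMCone.IsSymmetricAboutAxis R (closure (CMCone.c R : Set (CMCone.HR R)))) ∧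
      ∀ (M : Type u) [AddCommGroup M] [Module R M] [Module.Finite R M], CMCone.IsMCM R M →
        (CMCone.cls R M ∈ frontier (CMCone.c R : Set (CMCone.HR R)) ∨
          CMCone.cls R (Module.Dual R M) ∈ frontier (CMCone.c R : Set (CMCone.HR R))) →
        CMCone.SyzygyRanksGE R M) ∧
    -- totally reflexive modules
    (∀ (M : Type u) [AddCommGroup M] [Module R M] [Module.Finite R M],
      CMCone.IsTotallyReflexive R M →
      (CMCone.cls R M ∈ frontier (CMCone.c R : Set (CMCone.HR R)) ∨
        CMCone.cls R (Module.Dual R M) ∈ frontier (CMCone.c R : Set (CMCone.HR R))) →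
      CMCone.SyzygyRanksGE R M) := by
  have := hω.nontrivial
  refine ⟨⟨CMCone.mem_interior_c hR one_pos (zero_mem _) (by simp),
    CMCone.cls_mem_interior_of_finiteInjDim ω hR hω.isMCM hω.finiteInjDim⟩,
    CMCone.isStronglyConvexCone_closure_iff ω hR hω.isMCM hω.finiteInjDim,
    fun hG => ⟨⟨CMCone.isSymmetricAboutAxis_c hR hG, CMCone.isSymmetricAboutAxis_closure_c hR hG⟩,
      fun M _ _ _ hM h => (hM.isTotallyReflexive hR hG).syzygyRanksGE hR h⟩,
    fun M _ _ _ hM h => hM.syzygyRanksGE hR h⟩
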